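/- All graphs are finite and simple. Two letters $x \neq y$ alternate in a word $W$ if the word induced by $W$ on $\{x,y\}$ contains neither $xx$ nor $yy$ as a factor. A word $W$ over the vertex set $V$ of a graph $G=(V,E)$, in which every vertex occurs, represents $G$ if for all distinct $x,y\in V$: $xy\in E$ if and only if $x$ and $y$ alternate in $W$. The graph $G$ is (word-)representable if some word represents it. A word is $k$-uniform if each vertex occurs in it exactly $k$ times. The problem of deciding whether a given graph is representable is in NP. More precisely, encode a graph on the vertices $0,\dots,n-1$ as the bit string $1^n0$ followed by the $n^2$ entries of its adjacency matrix, row by row, and a word over $\{0,\dots,n-1\}$ by writing each letter $i$ as $1^i0$. Then the language of all encodings of representable graphs is in NP, and the following certificates witness this: the encodings of the words that represent the given graph on $n$ vertices and are $k$-uniform for some $k\le n$. That is, a graph is representable if and only if it has such a certificate, the length of the certificate is bounded by a polynomial in the length of the encoding of the graph, and the relation "$y$ is such a certificate for the graph encoded by $x$" is decidable in time polynomial in the length of the pair $(x,y)$. -/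

import Mathlib

namespace WordRep

open Computability Turing

section Words

variable {V : Type*} [DecidableEq V]

/-- The letters `x` and `y` alternate in `W`: the word induced by these two letters contains
neither `xx` nor `yy` as a factor. -/
def Alternate (W : List V) (x y : V) : Prop :=
  ¬ [x, x] <:+: W.filter (fun z => z = x ∨ z = y) ∧
    ¬ [y, y] <:+: W.filter (fun z => z = x ∨ z = y)

/-- The word `W`, whose letters are exactly the vertices, represents the graph `G`: distinct
vertices are adjacent if and only if they alternate in `W`. -/
def Represents (W : List V) (G : SimpleGraph V) : Prop :=
  (∀ v, v ∈ W) ∧ ∀ x y, x ≠ y → (G.Adj x y ↔ Alternate W x y)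

/-- Every vertex occurs exactly `k` times in the word `W`. -/
def IsUniform (k : ℕ) (W : List V) : Prop :=
  ∀ v, W.count v = k

/-- The graph `G` is (word-)representable. -/
def IsRepresentable (G : SimpleGraph V) : Prop :=
  ∃ W : List V, Represents W G

end Words

section Complexity

/-- The binary relation `R` on bit strings is decidable in polynomial time: its characteristic
function is computed by a (multi-stack) Turing machine in a number of steps that is
polynomial in the length of the pair. The pair `(x, y)` is written on the input tape as the bits of
`x` followed by the bits of `y`, the latter in a disjoint copy of the alphabet. -/
def PolyTimeDecidable (R : List Bool → List Bool → Prop) : Prop :=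
  ∃ f : List Bool × List Bool → Bool,
    (∀ x y, f (x, y) = true ↔ R x y) ∧
    Nonempty (TM2ComputableInPolyTime
      (encodingProd (encodingList Bool) (encodingList Bool)).encode encodeBool f)

/-- `R` is a polynomial-time verifier for the language `L`: it is decidable in polynomial time, and
a string is in `L` if and only if it has a certificate of polynomially bounded length. -/
def IsPolyTimeVerifier (R : List Bool → List Bool → Prop) (L : Language Bool) : Prop :=
  PolyTimeDecidable R ∧
    ∃ p : Polynomial ℕ, ∀ x, x ∈ L ↔ ∃ y : List Bool, y.length ≤ p.eval x.length ∧ R x y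

/-- The complexity class NP. -/
def NP : Set (Language Bool) :=
  {L | ∃ R : List Bool → List Bool → Prop, IsPolyTimeVerifier R L}

end Complexity

section Problem

open Classical in
/-- A graph on `n` vertices as a bit string: `n` in unary (`n` ones and a zero), followed by the
`n * n` entries of the adjacency matrix, row by row. -/
noncomputable def encodeGraph {n : ℕ} (G : SimpleGraph (Fin n)) : List Bool :=
  List.replicate n true ++ false ::
    (List.finRange n).flatMap fun i => (List.finRange n).map fun j => decide (G.Adj i j)

/-- A word over the vertices `0, …, n - 1` as a bit string: each letter `i` is written in unary
(`i` ones and a zero). -/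
def encodeWord {n : ℕ} (W : List (Fin n)) : List Bool :=
  W.flatMap fun i => List.replicate (i : ℕ) true ++ [false]

/-- The recognition problem for representable graphs: the set of all encodings of representable
graphs. -/
def representableGraphs : Language Bool :=
  {x | ∃ (n : ℕ) (G : SimpleGraph (Fin n)), IsRepresentable G ∧ encodeGraph G = x}

/-- The string `x` encodes a graph on `n` vertices, and `y` encodes a `k`-uniform word, for some
`k ≤ n`, that represents this graph. -/
def UniformWordCertificate (x y : List Bool) : Prop :=
  ∃ (n : ℕ) (G : SimpleGraph (Fin n)) (k : ℕ) (W : List (Fin n)),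
    encodeGraph G = x ∧ encodeWord W = y ∧ k ≤ n ∧ IsUniform k W ∧ Represents W G

end Problem

end WordRep

/-! Membership in NP requires short certificates and a fast check of them.

Short certificates (`IsRepresentable.exists_uniform`). A representing word orders the vertices: x ≤
y if every prefix contains x at least as often as y. Adjacent vertices are comparable. If a ≤ b ≤ c
≤ d with a, d adjacent, then the counts of b and c are squeezed between those of d and a, so b and c
alternate. Only this semi-transitive order is kept (`IsSemiTransitive`). A new word is a path of
count profiles V → ℕ, growing by one letter at a time from 0 to the constant n. It stays among the
admissible profiles, where on each edge the smaller vertex is level or one ahead, so edges alternate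
automatically. Any two admissible profiles h ≤ h' are joined by such a path
(`Admissible.exists_step`). Non-edges are destroyed by forcing the path through one profile per
vertex v, namely `lateProfile G v` shifted by a constant `f v`: there v lags one behind the vertices
incomparable to it and two behind its smaller non-neighbours. `exists_weaklyMonotone` chooses the
shifts such that these profiles form a chain bounded by n.

Fast check. The certificate relation is written in a small language of arithmetic terms with bounded
sums over an input string (`holds_certifiedTerm`, `uniformWordCertificate_iff`). By structural
induction, every term has polynomially bounded values and is computed in unary by a stack program in
polynomial time (`Term.exists_boundedBy`). Stack programs are simulated step for step by Turing
machines (`Cmd.Run.steps`). -/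

namespace WordRep

open Computability Turing

/-! ### Stack programs and their simulation by Turing machines -/

section StackPrograms

/-- Structured programs over stacks indexed by the natural numbers, with entries in `A`. -/
inductive Cmd (A : Type) : Type
  | skip : Cmd A
  | push : ℕ → A → Cmd A
  | seq : Cmd A → Cmd A → Cmd A
  /-- pop a stack and branch on the result -/
  | cases : ℕ → (Option A → Cmd A) → Cmd A
  /-- as long as the stack is nonempty, pop it and run the body on the popped entry -/
  | loop : ℕ → (A → Cmd A) → Cmd A

namespace Cmd

open Function (update)

variable {A : Type}

/-- `Run c S S' t`: started on the stacks `S`, the program `c` ends with the stacks `S'` after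
`t` steps. -/
inductive Run : Cmd A → (ℕ → List A) → (ℕ → List A) → ℕ → Prop
  | skip (S) : Run skip S S 1
  | push (k a S) : Run (push k a) S (update S k (a :: S k)) 1
  | seq {c₁ c₂ S S₁ S₂ t₁ t₂} : Run c₁ S S₁ t₁ → Run c₂ S₁ S₂ t₂ → Run (seq c₁ c₂) S S₂ (t₁ + t₂)
  | cases {k b S S' t} : Run (b (S k).head?) (update S k (S k).tail) S' t →
      Run (cases k b) S S' (t + 1)
  | loop_nil {k b S} : S k = [] → Run (loop k b) S S 1
  | loop_cons {k b S S₁ S₂ a l t₁ t₂} : S k = a :: l → Run (b a) (update S k l) S₁ t₁ →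
      Run (loop k b) S₁ S₂ t₂ → Run (loop k b) S S₂ (t₁ + t₂ + 1)

/-- The control positions inside a program. -/
def Pos : Cmd A → Type
  | skip => Unit
  | push _ _ => Unit
  | seq c₁ c₂ => Pos c₁ ⊕ Pos c₂
  | cases _ b => Option (Σ o, Pos (b o))
  | loop _ b => Option (Σ a, Pos (b a))

/-- The initial control position. -/
def entry : (c : Cmd A) → Pos c
  | skip => ()
  | push _ _ => ()
  | seq c₁ _ => Sum.inl (entry c₁)
  | cases _ _ => none
  | loop _ _ => none

/-- A program has finitely many control positions. -/
@[reducible]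
noncomputable def posFintype [Fintype A] : (c : Cmd A) → Fintype (Pos c)
  | skip => inferInstanceAs (Fintype Unit)
  | push _ _ => inferInstanceAs (Fintype Unit)
  | seq c₁ c₂ =>
    letI := posFintype c₁
    letI := posFintype c₂
    inferInstanceAs (Fintype (Pos c₁ ⊕ Pos c₂))
  | cases _ b =>
    letI := fun o => posFintype (b o)
    inferInstanceAs (Fintype (Option (Σ o, Pos (b o))))
  | loop _ b =>
    letI := fun a => posFintype (b a)
    inferInstanceAs (Fintype (Option (Σ a, Pos (b a))))

/-- All stacks used by the program have an index below this bound. -/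
def bound [Fintype A] : Cmd A → ℕ
  | skip => 0
  | push k _ => k + 1
  | seq c₁ c₂ => max (bound c₁) (bound c₂)
  | cases k b => max (k + 1) (Finset.univ.sup fun o => bound (b o))
  | loop k b => max (k + 1) (Finset.univ.sup fun a => bound (b a))

/-- The stack alphabets of the Turing machine: the output stack `none` holds bits. -/
abbrev Alph (A : Type) (m : ℕ) : Option (Fin m) → Type
  | none => Bool
  | some _ => A

/-- The machine code of a program, whose control positions are labelled by `emb` and which
continues at the label `exit`. -/
def code (m : ℕ) [NeZero m] {Λ : Type} :
    (c : Cmd A) → (Pos c → Λ) → Λ → Pos c → TM2.Stmt (Alph A m) Λ (Option A)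
  | skip, _, exit, _ => .goto fun _ => exit
  | push k a, _, exit, _ => .push (some (Fin.ofNat m k)) (fun _ => a) (.goto fun _ => exit)
  | seq c₁ c₂, emb, exit, p =>
    match p with
    | Sum.inl p => code m c₁ (fun q => emb (Sum.inl q)) (emb (Sum.inr (entry c₂))) p
    | Sum.inr p => code m c₂ (fun q => emb (Sum.inr q)) exit p
  | cases k b, emb, exit, p =>
    match p with
    | none => .pop (some (Fin.ofNat m k)) (fun _ o => o)
        (.goto fun o => emb (some ⟨o, entry (b o)⟩))
    | some ⟨o, p⟩ => code m (b o) (fun q => emb (some ⟨o, q⟩)) exit p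
  | loop k b, emb, exit, p =>
    match p with
    | none => .pop (some (Fin.ofNat m k)) (fun _ o => o)
        (.goto fun o => o.elim exit fun a => emb (some ⟨a, entry (b a)⟩))
    | some ⟨a, p⟩ => code m (b a) (fun q => emb (some ⟨a, q⟩)) (emb none) p

/-- The tapes of the machine, when the program has the stacks `S` and the output is `o`. -/
def tapes (m : ℕ) (S : ℕ → List A) (o : List Bool) : ∀ k, List (Alph A m k)
  | none => o
  | some i => S i

theorem update_tapes {m k : ℕ} [NeZero m] (hk : k < m) (S : ℕ → List A) (o : List Bool)
    (l : List A) :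
    update (tapes m S o) (some (Fin.ofNat m k)) l = tapes m (update S k l) o := by
  funext i
  rcases i with _ | i
  · rfl
  · rcases eq_or_ne i (Fin.ofNat m k) with rfl | h
    · simp [tapes, Nat.mod_eq_of_lt hk]
    · have h' : (i : ℕ) ≠ k := fun h' => h (by ext; simp [h', Nat.mod_eq_of_lt hk])
      rw [Function.update_of_ne (by simpa using h)]
      simp [tapes, Function.update_of_ne h']

theorem tapes_ofNat {m k : ℕ} [NeZero m] (hk : k < m) (S : ℕ → List A) (o : List Bool) :
    tapes m S o (some (Fin.ofNat m k)) = S k := by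
  simp [tapes, Nat.mod_eq_of_lt hk]

/-- `t` steps of the machine `M` lead from `c` to `c'`. -/
def Steps {σ : Type} (f : σ → Option σ) (t : ℕ) (c c' : σ) : Prop :=
  (flip bind f)^[t] (some c) = some c'

theorem Steps.trans {σ : Type} {f : σ → Option σ} {t₁ t₂ : ℕ} {a b c : σ}
    (h₁ : Steps f t₁ a b) (h₂ : Steps f t₂ b c) : Steps f (t₁ + t₂) a c := by
  unfold Steps at *
  rw [Nat.add_comm, Function.iterate_add_apply, h₁, h₂]

theorem Steps.one {σ : Type} {f : σ → Option σ} {a b : σ} (h : f a = some b) : Steps f 1 a b := h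

/-- The labelling `emb` and the label `exit` are arbitrary so that the induction applies to
subprograms inside a larger machine. The register `v` may start anywhere, since every pop overwrites
it before it is read. -/
theorem Run.steps [Fintype A] {m : ℕ} [NeZero m] {Λ : Type}
    {M : Λ → TM2.Stmt (Alph A m) Λ (Option A)} {c : Cmd A} {S S' : ℕ → List A} {t : ℕ}
    (h : Run c S S' t) (hm : bound c ≤ m) (emb : Pos c → Λ) (exit : Λ)
    (hM : ∀ p, M (emb p) = code m c emb exit p) (v : Option A) (o : List Bool) :
    ∃ v', Steps (TM2.step M) t ⟨some (emb (entry c)), v, tapes m S o⟩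
      ⟨some exit, v', tapes m S' o⟩ := by
  induction h generalizing v exit with
  | skip S =>
    refine ⟨v, Steps.one ?_⟩
    simp [hM, code]
  | push k a S =>
    refine ⟨v, Steps.one ?_⟩
    have hk : k < m := hm
    simp only [TM2.step, hM, code, TM2.stepAux]
    rw [tapes_ofNat hk, update_tapes hk]
  | @seq c₁ c₂ S S₁ S₂ t₁ t₂ _ _ ih₁ ih₂ =>
    simp only [bound, max_le_iff] at hm
    obtain ⟨v₁, h₁⟩ := ih₁ hm.1 (fun q => emb (Sum.inl q)) (emb (Sum.inr (entry c₂)))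
      (fun p => hM _) v
    obtain ⟨v₂, h₂⟩ := ih₂ hm.2 (fun q => emb (Sum.inr q)) exit (fun p => hM _) v₁
    exact ⟨v₂, h₁.trans h₂⟩
  | @cases k b S S' t _ ih =>
    simp only [bound, max_le_iff, Finset.sup_le_iff] at hm
    have hk : k < m := hm.1
    obtain ⟨v₁, h₁⟩ := ih (hm.2 _ (Finset.mem_univ _)) (fun q => emb (some ⟨_, q⟩)) exit
      (fun p => hM _) (S k).head?
    refine ⟨v₁, ?_⟩
    rw [Nat.add_comm]
    refine Steps.trans (Steps.one ?_) h₁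
    have e : M (emb none) = .pop (some (Fin.ofNat m k)) (fun _ o => o)
        (.goto fun o => emb (some ⟨o, entry (b o)⟩)) := hM none
    change some (TM2.stepAux (M (emb none)) v (tapes m S o)) = _
    rw [e]
    simp only [TM2.stepAux]
    rw [tapes_ofNat hk, update_tapes hk]
  | @loop_nil k b S hS =>
    simp only [bound, max_le_iff, Finset.sup_le_iff] at hm
    have hk : k < m := hm.1
    refine ⟨none, Steps.one ?_⟩
    have e : M (emb none) = .pop (some (Fin.ofNat m k)) (fun _ o => o)
        (.goto fun o => o.elim exit fun a => emb (some ⟨a, entry (b a)⟩)) := hM none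
    change some (TM2.stepAux (M (emb none)) v (tapes m S o)) = _
    rw [e]
    simp only [TM2.stepAux]
    rw [tapes_ofNat hk, update_tapes hk, hS]
    have hu : update S k [] = S := by rw [← hS, Function.update_eq_self]
    simp [hu]
  | @loop_cons k b S S₁ S₂ a l t₁ t₂ hS _ _ ih₁ ih₂ =>
    obtain ⟨hk, hb⟩ : k < m ∧ ∀ a, bound (b a) ≤ m := by
      simp only [bound, max_le_iff, Finset.sup_le_iff] at hm
      exact ⟨hm.1, fun a => hm.2 a (Finset.mem_univ _)⟩
    obtain ⟨v₁, h₁⟩ := ih₁ (hb a) (fun q => emb (some ⟨_, q⟩)) (emb none)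
      (fun p => hM _) (some a)
    obtain ⟨v₂, h₂⟩ := ih₂ hm emb exit hM v₁
    refine ⟨v₂, ?_⟩
    rw [Nat.add_comm]
    refine Steps.trans (Steps.one ?_) (h₁.trans h₂)
    have e : M (emb none) = .pop (some (Fin.ofNat m k)) (fun _ o => o)
        (.goto fun o => o.elim exit fun a => emb (some ⟨a, entry (b a)⟩)) := hM none
    change some (TM2.stepAux (M (emb none)) v (tapes m S o)) = _
    rw [e]
    simp only [TM2.stepAux]
    rw [tapes_ofNat hk, update_tapes hk, hS]
    rfl

/-- The machine code that runs a program, and then outputs whether stack `j` is nonempty. -/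
def mainCode [Fintype A] (c : Cmd A) (j m : ℕ) [NeZero m] :
    Option (Pos c) → TM2.Stmt (Alph A m) (Option (Pos c)) (Option A)
  -- The register is reset at the end because the halting configuration must carry the initial
  -- internal state.
  | none => .pop (some (Fin.ofNat m j)) (fun _ o => o)
      (.push none (fun o => o.isSome) (.load (fun _ => none) .halt))
  | some p => code m c some none p

/-- The Turing machine that runs a program on stack `0`, and outputs whether stack `j` is
nonempty. -/
noncomputable def machine [Fintype A] (c : Cmd A) (j m : ℕ) [NeZero m] : FinTM2 :=
  letI := posFintype c
  { K := Option (Fin m)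
    k₀ := some (Fin.ofNat m 0)
    k₁ := none
    Γ := Alph A m
    Λ := Option (Pos c)
    main := some (entry c)
    σ := Option A
    initialState := none
    Γk₀Fin := inferInstanceAs (Fintype A)
    m := mainCode c j m }

/-- A function that is decided by a program within polynomial time is computable in polynomial
time. -/
theorem nonempty_computable [Fintype A] [Inhabited A] {α : Type} (ea : α → List A) (f : α → Bool) (c : Cmd A)
    (j : ℕ) (p : Polynomial ℕ)
    (h : ∀ a, ∃ t ≤ p.eval (ea a).length,
      Run c (update (fun _ => []) 0 (ea a))
        (update (fun _ => []) j (if f a then [default] else [])) t) :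
    Nonempty (TM2ComputableInPolyTime ea encodeBool f) := by
  obtain ⟨m, hc, hj⟩ : ∃ m, bound c ≤ m + 1 ∧ j < m + 1 :=
    ⟨max (bound c) j, by omega, by omega⟩
  choose t ht hr using h
  refine ⟨⟨⟨machine c j (m + 1), Equiv.refl A, Equiv.refl Bool⟩, p + 1, fun a => ⟨⟨t a + 1, ?_⟩, ?_⟩⟩⟩
  · have hinit : initList (machine c j (m + 1)) (ea a) =
        ⟨some (some (entry c)), none, tapes (m + 1) (update (fun _ => []) 0 (ea a)) []⟩ := by
      unfold initList
      congr 1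
      funext k
      rcases k with _ | i
      · rfl
      · rcases eq_or_ne i 0 with rfl | hi
        · rfl
        · have h1 : (some i : Option (Fin (m + 1))) ≠ some (Fin.ofNat (m + 1) 0) :=
            fun h => hi (Option.some.inj h)
          have h2 : (i : ℕ) ≠ 0 := Fin.val_ne_zero_iff.2 hi
          refine (dif_neg h1).trans ?_
          exact (Function.update_of_ne (f := fun _ => ([] : List A)) h2 (ea a)).symm
    have hhalt : haltList (machine c j (m + 1)) [f a] =
        ⟨none, none, tapes (m + 1) (fun _ => []) [f a]⟩ := by
      unfold haltList
      congr 1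
      funext k
      rcases k with _ | i
      · rfl
      · rfl
    have hin : initList (machine c j (m + 1)) (List.map (Equiv.refl A).invFun (ea a)) = _ :=
      (congrArg (initList (machine c j (m + 1))) (List.map_id _)).trans hinit
    have hout : haltList (machine c j (m + 1))
        (List.map (Equiv.refl Bool).invFun (encodeBool (f a))) = _ :=
      (congrArg (haltList (machine c j (m + 1))) (List.map_id _)).trans hhalt
    obtain ⟨v, hv⟩ := (hr a).steps (M := mainCode c j (m + 1)) hc some none (fun p => rfl) none []
    have hlast : Steps (TM2.step (mainCode c j (m + 1))) 1
        ⟨some none, v, tapes (m + 1) (update (fun _ => []) j (if f a then [default] else [])) []⟩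
        ⟨none, none, tapes (m + 1) (fun _ => []) [f a]⟩ := by
      refine Steps.one ?_
      simp only [TM2.step, mainCode, TM2.stepAux]
      rw [tapes_ofNat hj, update_tapes hj]
      congr 2
      funext k
      rcases k with _ | i
      · by_cases hf : f a <;> simp [tapes, hf]
      · by_cases hf : f a <;> simp [tapes, hf]
    exact (congrArg (fun x => (flip bind (machine c j (m + 1)).step)^[t a + 1] (some x)) hin).trans
      (Eq.trans (Steps.trans hv hlast) (congrArg some hout.symm))
  · simp only [Polynomial.eval_add, Polynomial.eval_one]
    have := ht a
    omega

end Cmd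

end StackPrograms

end WordRep

namespace WordRep

open Computability Turing

/-! ### Running times of basic stack programs -/

section Terms

namespace Cmd

open Function (update)

variable {A : Type}

/-- Started on the stacks `S`, the program ends with the stacks `S'` after at most `T` steps. -/
def Reach (c : Cmd A) (S S' : ℕ → List A) (T : ℕ) : Prop :=
  ∃ t ≤ T, Run c S S' t

theorem Reach.mono {c : Cmd A} {S S' : ℕ → List A} {T T' : ℕ} (h : Reach c S S' T) (hT : T ≤ T') :
    Reach c S S' T' :=
  let ⟨t, ht, hr⟩ := h
  ⟨t, ht.trans hT, hr⟩

theorem Reach.seq {c₁ c₂ : Cmd A} {S S₁ S₂ : ℕ → List A} {T₁ T₂ : ℕ} (h₁ : Reach c₁ S S₁ T₁)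
    (h₂ : Reach c₂ S₁ S₂ T₂) : Reach (.seq c₁ c₂) S S₂ (T₁ + T₂) :=
  let ⟨_, ht₁, hr₁⟩ := h₁
  let ⟨_, ht₂, hr₂⟩ := h₂
  ⟨_, Nat.add_le_add ht₁ ht₂, .seq hr₁ hr₂⟩

theorem reach_skip (S : ℕ → List A) : Reach .skip S S 1 :=
  ⟨1, le_rfl, .skip S⟩

theorem reach_push (k : ℕ) (a : A) (S : ℕ → List A) :
    Reach (.push k a) S (update S k (a :: S k)) 1 :=
  ⟨1, le_rfl, .push k a S⟩

theorem Reach.cases {k : ℕ} {b : Option A → Cmd A} {S S' : ℕ → List A} {T : ℕ}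
    (h : Reach (b (S k).head?) (update S k (S k).tail) S' T) : Reach (.cases k b) S S' (T + 1) :=
  let ⟨_, ht, hr⟩ := h
  ⟨_, Nat.succ_le_succ ht, .cases hr⟩

theorem reach_loop_nil {k : ℕ} {b : A → Cmd A} {S : ℕ → List A} (h : S k = []) :
    Reach (.loop k b) S S 1 :=
  ⟨1, le_rfl, .loop_nil h⟩

theorem Reach.loop_cons {k : ℕ} {b : A → Cmd A} {S S₁ S₂ : ℕ → List A} {a : A} {l : List A}
    {T₁ T₂ : ℕ} (h : S k = a :: l) (h₁ : Reach (b a) (update S k l) S₁ T₁)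
    (h₂ : Reach (.loop k b) S₁ S₂ T₂) : Reach (.loop k b) S S₂ (T₁ + T₂ + 1) :=
  let ⟨_, ht₁, hr₁⟩ := h₁
  let ⟨_, ht₂, hr₂⟩ := h₂
  ⟨_, Nat.succ_le_succ (Nat.add_le_add ht₁ ht₂), .loop_cons h hr₁ hr₂⟩

/-- Moving a stack onto another one. -/
theorem reach_move {k j : ℕ} (hkj : k ≠ j) (S : ℕ → List A) :
    Reach (.loop k fun a => .push j a) S (update (update S k []) j ((S k).reverse ++ S j))
      (2 * (S k).length + 1) := by
  generalize hl : S k = l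
  induction l generalizing S with
  | nil =>
    have hu : update S k [] = S := by rw [← hl, Function.update_eq_self]
    have : update (update S k []) j (([] : List A).reverse ++ S j) = S := by
      simp [hu]
    rw [this]
    exact (reach_loop_nil hl).mono (by simp)
  | cons a l ih =>
    have h := ih (update (update S k l) j (a :: S j)) (by simp [Function.update_of_ne hkj])
    refine (Reach.loop_cons hl (reach_push j a _) (S₂ := _) (T₂ := _) ?_).mono
      (T := 1 + (2 * l.length + 1) + 1) (by simp only [List.length_cons]; omega)
    rw [Function.update_of_ne hkj.symm]
    convert h using 1
    funext i
    simp only [Function.update_apply]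
    split_ifs <;> simp_all

/-- The unary representation of a number. -/
def unary [Inhabited A] (n : ℕ) : List A :=
  List.replicate n default

variable [Inhabited A]

@[simp]
theorem unary_zero : unary 0 = ([] : List A) := rfl

theorem unary_succ (n : ℕ) : unary (n + 1) = default :: (unary n : List A) := rfl

@[simp]
theorem length_unary (n : ℕ) : (unary n : List A).length = n := List.length_replicate

theorem unary_append (m n : ℕ) : unary m ++ unary n = (unary (m + n) : List A) :=
  List.replicate_append_replicate

@[simp]
theorem reverse_unary (n : ℕ) : (unary n).reverse = (unary n : List A) := List.reverse_replicate

/-- A loop whose `n`-th last iteration starts with the stacks `σ n`. -/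
theorem Reach.loop {k : ℕ} {b : A → Cmd A} (σ : ℕ → ℕ → List A) (T n : ℕ)
    (hk : ∀ m, σ m k = unary m)
    (h : ∀ m < n, Reach (b default) (update (σ (m + 1)) k (unary m)) (σ m) T) :
    Reach (.loop k b) (σ n) (σ 0) (n * (T + 1) + 1) := by
  induction n with
  | zero => exact (reach_loop_nil (hk 0)).mono (by omega)
  | succ n ih =>
    refine (Reach.loop_cons ((hk _).trans (unary_succ n)) (h n (by omega))
      (ih fun m hm => h m (by omega))).mono ?_
    rw [Nat.succ_mul]
    omega

/-- Adding the length of stack `k` to stack `d`, with the help of stack `j`. -/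
def addLength (k d j : ℕ) : Cmd A :=
  .seq (.loop k fun a => .seq (.push d default) (.push j a)) (.loop j fun a => .push k a)

theorem reach_addLength {k d j : ℕ} (hkd : k ≠ d) (hkj : k ≠ j) (hdj : d ≠ j) (S : ℕ → List A)
    (hj : S j = []) (hd : S d = []) :
    Reach (addLength k d j) S (update S d (unary (S k).length)) (5 * (S k).length + 2) := by
  have key : ∀ (l : List A) (S : ℕ → List A), S k = l →
      Reach (.loop k fun a => .seq (.push d default) (.push j a)) S
        (update (update (update S k []) d (unary l.length ++ S d)) j (l.reverse ++ S j))
        (3 * l.length + 1) := by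
    intro l
    induction l with
    | nil =>
      intro S hl
      have hu : update S k [] = S := by rw [← hl, Function.update_eq_self]
      have : update (update (update S k []) d ((unary ([] : List A).length ++ S d))) j
          (([] : List A).reverse ++ S j) = S := by
        simp [hu]
      rw [this]
      exact (reach_loop_nil hl).mono (by simp)
    | cons a l ih =>
      intro S hl
      have h := ih (update (update (update S k l) d (default :: S d)) j (a :: S j))
        (by simp [Function.update_of_ne hkj, Function.update_of_ne hkd])
      refine (Reach.loop_cons hl ((reach_push d default _).seq (reach_push j a _))
        (S₂ := _) (T₂ := _) ?_).mono
        (T := 1 + 1 + (3 * l.length + 1) + 1) (by simp only [List.length_cons]; omega)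
      rw [Function.update_of_ne hkd.symm, Function.update_of_ne hdj.symm,
        Function.update_of_ne hkj.symm]
      convert h using 1
      have e : (unary l.length : List A) ++ default :: S d = default :: (unary l.length ++ S d) := by
        rw [← List.cons_append, ← unary_succ, ← unary_append l.length 1]
        simp [unary_succ]
      funext i
      simp only [Function.update_apply]
      split_ifs <;> simp_all [unary_succ]
  have h := (key _ S rfl).seq (reach_move hkj.symm _)
  unfold addLength
  convert h using 1
  · funext i
    simp only [Function.update_apply, hj, hd]
    split_ifs <;> simp_all
  · simp [hj]
    ring

end Cmd

end Terms

end WordRep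

namespace WordRep

open Computability Turing

/-! ### Arithmetic terms and their evaluation in polynomial time -/

section Terms

/-- Terms for natural numbers that depend on an input string over `A`. -/
inductive Term (A : Type) : Type
  | var : ℕ → Term A
  | one : Term A
  /-- the length of the input -/
  | len : Term A
  /-- whether the input has an entry with the given property at a position -/
  | sym : (A → Bool) → Term A → Term A
  | add : Term A → Term A → Term A
  | sub : Term A → Term A → Term A
  /-- the sum of the second term, whose variable `0` runs over the numbers below the first term -/
  | sum : Term A → Term A → Term A

/-- The sequence `f`, shifted by a new entry at the beginning. -/
def scons {α : Type} (a : α) (f : ℕ → α) : ℕ → α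
  | 0 => a
  | i + 1 => f i

namespace Term

open Function (update)
open Cmd (Reach unary)

variable {A : Type}

/-- The value of a term for the input `z`. -/
def eval (z : List A) : Term A → (ℕ → ℕ) → ℕ
  | var i, ρ => ρ i
  | one, _ => 1
  | len, _ => z.length
  | sym f t, ρ => if z[t.eval z ρ]?.any f then 1 else 0
  | add s t, ρ => s.eval z ρ + t.eval z ρ
  | sub s t, ρ => s.eval z ρ - t.eval z ρ
  | sum s t, ρ => ∑ p ∈ Finset.range (s.eval z ρ), t.eval z (scons p ρ)

variable [Inhabited A]

/-- A program that computes a term in unary on the stack `d`, if variable `i` is stored on the stack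
`loc i`, the input on stack `0`, and stack `1` and the stacks from `d` on are empty. -/
def compile : Term A → (ℕ → ℕ) → ℕ → Cmd A
  | var i, loc, d => .addLength (loc i) d 1
  | one, _, d => .push d default
  | len, _, d => .addLength 0 d 1
  -- The input is wound onto stack `1` up to the required position, inspected there, and wound back.
  | sym f t, loc, d => .seq (t.compile loc d) <|
      .seq (.loop d fun _ => .cases 0 fun o => o.elim .skip (.push 1)) <|
      .seq (.cases 0 fun o => .seq (o.elim .skip (.push 0))
        (if o.any f then .push d default else .skip))
      (.loop 1 fun a => .push 0 a)
  | add s t, loc, d => .seq (s.compile loc d) <|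
      .seq (t.compile loc (d + 1)) (.loop (d + 1) fun a => .push d a)
  -- Popping an empty stack does nothing, which yields truncated subtraction.
  | sub s t, loc, d => .seq (s.compile loc d) <|
      .seq (t.compile loc (d + 1)) (.loop (d + 1) fun _ => .cases d fun _ => .skip)
  -- The loop counter on stack `d` doubles as the bound variable: after each pop it holds the
  -- current index in unary, running downwards to 0. Stack `d + 1` accumulates the sum.
  | sum s t, loc, d => .seq (s.compile loc d) <|
      .seq (.loop d fun _ => .seq (t.compile (scons d loc) (d + 2))
        (.loop (d + 2) fun a => .push (d + 1) a)) (.loop (d + 1) fun a => .push d a)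

/-- The stacks in which the compiled program of a term is started. -/
structure Layout (z : List A) (ρ loc : ℕ → ℕ) (d : ℕ) (S : ℕ → List A) : Prop where
  input : S 0 = z
  aux : S 1 = []
  two_le : ∀ i, 2 ≤ loc i
  loc_lt : ∀ i, loc i < d
  var : ∀ i, S (loc i) = unary (ρ i)
  free : ∀ j, d ≤ j → S j = []

namespace Layout

variable {z : List A} {ρ loc : ℕ → ℕ} {d : ℕ} {S : ℕ → List A}

theorem two_lt (h : Layout z ρ loc d S) : 2 < d :=
  (h.two_le 0).trans_lt (h.loc_lt 0)

theorem update (h : Layout z ρ loc d S) (l : List A) :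
    Layout z ρ loc (d + 1) (update S d l) := by
  have hd := h.two_lt
  refine ⟨?_, ?_, h.two_le, fun i => (h.loc_lt i).trans (Nat.lt_succ_self d), fun i => ?_,
    fun j hj => ?_⟩
  · rw [Function.update_of_ne (by omega), h.input]
  · rw [Function.update_of_ne (by omega), h.aux]
  · rw [Function.update_of_ne (h.loc_lt i).ne, h.var]
  · rw [Function.update_of_ne (by omega), h.free j (by omega)]

theorem scons (h : Layout z ρ loc d S) (n : ℕ) :
    Layout z (scons n ρ) (scons d loc) (d + 1) (Function.update S d (unary n)) := by
  have h' := h.update (unary n)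
  refine ⟨h'.input, h'.aux, fun i => ?_, fun i => ?_, fun i => ?_, h'.free⟩
  · rcases i with _ | i
    exacts [h.two_lt.le, h.two_le i]
  · rcases i with _ | i
    exacts [Nat.lt_succ_self d, h'.loc_lt i]
  · rcases i with _ | i
    · exact Function.update_self ..
    · exact h'.var i

end Layout

/-- The polynomial `p` bounds the value of the term and the running time of its compiled program. -/
def BoundedBy (t : Term A) (p : Polynomial ℕ) : Prop :=
  ∀ (z : List A) (ρ : ℕ → ℕ) (N : ℕ), z.length ≤ N → (∀ i, ρ i ≤ N) → t.eval z ρ ≤ p.eval N ∧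
    ∀ loc d S, Layout z ρ loc d S →
      Reach (t.compile loc d) S (update S d (unary (t.eval z ρ))) (p.eval N)

theorem boundedBy_var (i : ℕ) :
    BoundedBy (var i : Term A) (5 * .X + 2) := by
  intro z ρ N hz hρ
  refine ⟨?_, fun loc d S h => ?_⟩
  · have := hρ i
    simp [eval]
    omega
  · have h2 := h.two_le i
    have hd := h.two_lt
    have := Cmd.reach_addLength (j := 1) (h.loc_lt i).ne (by omega) (by omega) S h.aux
      (h.free d le_rfl)
    rw [h.var, Cmd.length_unary] at this
    have hi := hρ i
    refine this.mono ?_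
    simp
    omega

theorem boundedBy_one :
    BoundedBy (one : Term A) (1) := by
  intro z ρ N hz hρ
  refine ⟨by simp [eval], fun loc d S h => ?_⟩
  have := Cmd.reach_push d default S
  rw [h.free d le_rfl] at this
  simpa [eval, compile, Cmd.unary_succ] using this

theorem boundedBy_len :
    BoundedBy (len : Term A) (5 * .X + 2) := by
  intro z ρ N hz hρ
  refine ⟨?_, fun loc d S h => ?_⟩
  · simp [eval]
    omega
  · have hd := h.two_lt
    have := Cmd.reach_addLength (k := 0) (j := 1) (d := d) (by omega) (by omega) (by omega) S
      h.aux (h.free d le_rfl)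
    rw [h.input] at this
    refine this.mono ?_
    simp
    omega

theorem BoundedBy.sym (f : A → Bool) {t : Term A} {p : Polynomial ℕ} (hp : t.BoundedBy p) :
    BoundedBy (sym f t : Term A) (4 * p + 2 * .X + 10) := by
  intro z ρ N hz hρ
  refine ⟨?_, fun loc d S h => ?_⟩
  · simp only [eval]
    split_ifs <;> simp
  obtain ⟨hv, hr⟩ := hp z ρ N hz hρ
  have hd := h.two_lt
  have h0 := h.input
  have h1 := h.aux
  have hdd := h.free d le_rfl
  set v := t.eval z ρ with hv'
  have r₁ := hr loc d S h
  have r₂ : Reach (.loop d fun _ => .cases 0 fun o => o.elim .skip (.push 1))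
      (update S d (unary v))
      (update (update S 0 (z.drop v)) 1 (z.take v).reverse) (v * (2 + 1) + 1) := by
    have := Cmd.Reach.loop (k := d) (b := fun _ => .cases 0 fun o => o.elim .skip (.push 1))
      -- With `n` iterations left, `v - n` symbols have been moved, or all of them if the input is
      -- shorter.
      (fun n => update (update (update S d (unary n)) 0 (z.drop (v - n))) 1
        (z.take (v - n)).reverse) 2 v ?_ ?_
    · convert this using 1
      · funext j
        simp only [Function.update_apply]
        split_ifs <;> first | omega | simp_all
      · funext j
        simp only [Function.update_apply]
        split_ifs <;> first | omega | simp_all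
    · intro m
      rw [Function.update_of_ne (by omega), Function.update_of_ne (by omega),
        Function.update_self]
    · intro m hm
      refine Cmd.Reach.cases ?_
      obtain ⟨e, he, he'⟩ : ∃ e, v - (m + 1) = e ∧ v - m = e + 1 := ⟨_, rfl, by omega⟩
      simp only [he, he']
      rw [Function.update_of_ne (by omega), Function.update_of_ne (by omega),
        Function.update_self]
      rcases lt_or_ge e z.length with hez | hez
      · rw [List.drop_eq_getElem_cons hez, List.take_succ_eq_append_getElem hez]
        change Reach (.push 1 z[e]) _ _ _
        convert Cmd.reach_push 1 z[e] _ using 1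
        funext j
        simp only [Function.update_apply]
        split_ifs <;> first | omega | simp_all
      · rw [List.drop_eq_nil_of_le hez, List.drop_eq_nil_of_le (hez.trans e.le_succ),
          List.take_of_length_le hez, List.take_of_length_le (hez.trans e.le_succ)]
        change Reach .skip _ _ _
        convert Cmd.reach_skip _ using 1
        funext j
        simp only [Function.update_apply]
        split_ifs <;> first | omega | simp_all
  have r₃ : Reach (.cases 0 fun o => .seq (o.elim .skip (.push 0))
      (if o.any f then .push d default else .skip))
      (update (update S 0 (z.drop v)) 1 (z.take v).reverse)
      (update (update (update S 0 (z.drop v)) 1 (z.take v).reverse) d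
        (unary (if z[v]?.any f then 1 else 0))) (1 + 1 + 1) := by
    refine Cmd.Reach.cases ?_
    refine Cmd.Reach.seq (S₁ := update (update S 0 (z.drop v)) 1 (z.take v).reverse) ?_ ?_
    · rw [Function.update_of_ne (by omega), Function.update_self]
      rcases lt_or_ge v z.length with hvz | hvz
      · rw [List.drop_eq_getElem_cons hvz]
        change Reach (.push 0 z[v]) _ _ _
        convert Cmd.reach_push 0 z[v] _ using 1
        funext j
        simp only [Function.update_apply]
        split_ifs <;> first | omega | simp_all
      · rw [List.drop_eq_nil_of_le hvz]
        change Reach .skip _ _ _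
        convert Cmd.reach_skip _ using 1
        funext j
        simp only [Function.update_apply]
        split_ifs <;> first | omega | simp_all
    · rw [Function.update_of_ne (by omega), Function.update_self, List.head?_drop]
      split_ifs
      · convert Cmd.reach_push d default _ using 1
        rw [Function.update_of_ne (by omega), Function.update_of_ne (by omega), hdd]
        rfl
      · convert Cmd.reach_skip _ using 1
        funext j
        simp only [Function.update_apply]
        split_ifs <;> first | omega | simp_all
  have r₄ := Cmd.reach_move (k := 1) (j := 0) (by omega)
    (update (update (update S 0 (z.drop v)) 1 (z.take v).reverse) d
        (unary (if z[v]?.any f then 1 else 0)))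
  have r := r₁.seq (r₂.seq (r₃.seq r₄))
  rw [Function.update_of_ne (a := 1) (a' := d) (by omega),
    Function.update_of_ne (a := 0) (a' := d) (by omega), Function.update_self,
    Function.update_of_ne (a := 0) (a' := 1) (by omega), Function.update_self,
    List.reverse_reverse, List.take_append_drop] at r
  refine Cmd.Reach.mono (T := p.eval N +
    (v * (2 + 1) + 1 + (1 + 1 + 1 + (2 * (z.take v).reverse.length + 1)))) ?_ ?_
  · rw [compile]
    convert r using 1
    funext j
    simp only [Function.update_apply, eval]
    split_ifs <;> first | omega | simp_all
  · have : (z.take v).reverse.length ≤ z.length := by simp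
    simp only [Polynomial.eval_add, Polynomial.eval_mul, Polynomial.eval_ofNat,
      Polynomial.eval_X]
    omega

theorem BoundedBy.add {s t : Term A} {p q : Polynomial ℕ} (hp : s.BoundedBy p) (hq : t.BoundedBy q) :
    BoundedBy (add s t : Term A) (p + 3 * q + 1) := by
  intro z ρ N hz hρ
  obtain ⟨hv, hr⟩ := hp z ρ N hz hρ
  obtain ⟨hv', hr'⟩ := hq z ρ N hz hρ
  simp only [Polynomial.eval_add, Polynomial.eval_mul, Polynomial.eval_ofNat,
    Polynomial.eval_one, eval]
  refine ⟨by omega, fun loc d S h => ?_⟩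
  set v := s.eval z ρ
  set w := t.eval z ρ
  have r := (hr loc d S h).seq ((hr' loc (d + 1) _ (h.update _)).seq
    (Cmd.reach_move (k := d + 1) (j := d) (by omega) _))
  rw [Function.update_self, Function.update_of_ne (by omega), Function.update_self,
    Cmd.reverse_unary, Cmd.unary_append, Cmd.length_unary] at r
  refine Cmd.Reach.mono (T := p.eval N + (q.eval N + (2 * w + 1))) ?_ ?_
  · rw [compile]
    convert r using 1
    funext j
    have := h.free (d + 1) (by omega)
    simp only [Function.update_apply]
    split_ifs <;> simp_all [Nat.add_comm]
  · omega

theorem BoundedBy.sub {s t : Term A} {p q : Polynomial ℕ} (hp : s.BoundedBy p) (hq : t.BoundedBy q) :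
    BoundedBy (sub s t : Term A) (p + 4 * q + 1) := by
  intro z ρ N hz hρ
  obtain ⟨hv, hr⟩ := hp z ρ N hz hρ
  obtain ⟨hv', hr'⟩ := hq z ρ N hz hρ
  simp only [Polynomial.eval_add, Polynomial.eval_mul, Polynomial.eval_ofNat,
    Polynomial.eval_one, eval]
  refine ⟨by omega, fun loc d S h => ?_⟩
  set v := s.eval z ρ
  set w := t.eval z ρ
  have r₃ := Cmd.Reach.loop (k := d + 1) (b := fun _ => .cases d fun _ => .skip)
    (fun n => update (update S (d + 1) (unary n)) d (unary (v - (w - n)))) 2 w ?_ ?_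
  · have r₃' : Reach (.loop (d + 1) fun _ => .cases d fun _ => .skip)
        (update (update S d (unary v)) (d + 1) (unary w)) (update S d (unary (v - w)))
        (w * (2 + 1) + 1) := by
      have := h.free (d + 1) (by omega)
      convert r₃ using 1
      · funext j
        simp only [Function.update_apply]
        split_ifs <;> first | omega | simp_all
      · funext j
        simp only [Function.update_apply]
        split_ifs <;> first | omega | simp_all
    have r := (hr loc d S h).seq ((hr' loc (d + 1) _ (h.update _)).seq r₃')
    exact r.mono (by omega)
  · intro m
    rw [Function.update_of_ne (by omega), Function.update_self]
  · intro m hm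
    refine Cmd.Reach.cases (T := 1) ?_
    convert Cmd.reach_skip _ using 1
    have : (unary (v - (w - m)) : List A) = (unary (v - (w - (m + 1)))).tail := by
      simp only [unary, List.tail_replicate]
      congr 1
      omega
    funext j
    simp only [Function.update_apply]
    split_ifs <;> first | omega | simp_all

theorem BoundedBy.sum {s t : Term A} {p q : Polynomial ℕ} (hp : s.BoundedBy p) (hq : t.BoundedBy q) :
    BoundedBy (sum s t : Term A) (p + p * (5 * q.comp (.X + p) + 2) + 2) := by
  intro z ρ N hz hρ
  obtain ⟨hv, hr⟩ := hp z ρ N hz hρ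
  simp only [Polynomial.eval_add, Polynomial.eval_mul, Polynomial.eval_ofNat,
    Polynomial.eval_X, eval, Polynomial.eval_comp]
  set v := s.eval z ρ
  -- The bound variable may be as large as `p.eval N`, so the body has to be estimated at `N +
  -- p.eval N`; this is the origin of the composition of polynomials.
  have hq' : ∀ m < v, _ := fun m hm => hq z (scons m ρ) (N + p.eval N) (by omega) (by
    rintro (_ | i)
    · simp only [scons]; omega
    · have := hρ i
      simp only [scons]; omega)
  set Q := q.eval (N + p.eval N)
  set P := p.eval N
  set F : ℕ → ℕ := fun m => t.eval z (scons m ρ) with hF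
  have hsum : ∑ m ∈ Finset.range v, F m ≤ P * Q := by
    refine (Finset.sum_le_card_nsmul _ _ Q fun m hm => (hq' m (Finset.mem_range.1 hm)).1).trans ?_
    simp only [Finset.card_range, smul_eq_mul]
    gcongr
  refine ⟨by nlinarith, fun loc d S h => ?_⟩
  have hd1 := h.free (d + 1) (by omega)
  have hd2 := h.free (d + 2) (by omega)
  have r₂ := Cmd.Reach.loop (k := d)
    (b := fun _ => .seq (t.compile (scons d loc) (d + 2))
      (.loop (d + 2) fun a => .push (d + 1) a))
    (fun n => update (update S d (unary n)) (d + 1)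
      (unary (∑ m ∈ Finset.Ico n v, F m))) (Q + (2 * Q + 1)) v ?_ ?_
  · have r₃ := Cmd.reach_move (k := d + 1) (j := d) (by omega)
      (update (update S d []) (d + 1) (unary (∑ m ∈ Finset.Ico 0 v, F m)))
    have r₂' : Reach (.loop d fun _ => .seq (t.compile (scons d loc) (d + 2))
        (.loop (d + 2) fun a => .push (d + 1) a)) (update S d (unary v))
        (update (update S d []) (d + 1) (unary (∑ m ∈ Finset.Ico 0 v, F m)))
        (v * (Q + (2 * Q + 1) + 1) + 1) := by
      convert r₂ using 1
      funext j
      simp only [Function.update_apply]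
      split_ifs <;> first | omega | simp_all
      rw [Cmd.unary_zero]
    have r := (hr loc d S h).seq (r₂'.seq r₃)
    rw [Function.update_self, Function.update_of_ne (by omega), Function.update_self,
      Cmd.reverse_unary, List.append_nil, Cmd.length_unary, ← Finset.range_eq_Ico] at r
    refine Cmd.Reach.mono
      (T := P + (v * (Q + (2 * Q + 1) + 1) + 1 + (2 * ∑ m ∈ Finset.range v, F m + 1))) ?_ ?_
    · rw [compile]
      convert r using 1
      funext j
      simp only [Function.update_apply]
      split_ifs <;> first | omega | simp_all
    · nlinarith
  · intro m
    rw [Function.update_of_ne (by omega), Function.update_self]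
  · intro m hm
    obtain ⟨hv', hr'⟩ := hq' m hm
    have r₁ := hr' (scons d loc) (d + 2) _ ((h.scons m).update
      (unary (∑ m ∈ Finset.Ico (m + 1) v, F m)))
    have r := r₁.seq (Cmd.reach_move (k := d + 2) (j := d + 1) (by omega) _)
    rw [Function.update_self, Function.update_of_ne (by omega), Function.update_self,
      Cmd.reverse_unary, Cmd.unary_append, Cmd.length_unary] at r
    refine Cmd.Reach.mono (T := Q + (2 * F m + 1)) ?_ ?_
    · convert r using 1
      · funext j
        simp only [Function.update_apply]
        split_ifs <;> first | omega | simp_all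
      · rw [Finset.sum_eq_sum_Ico_succ_bot hm]
        funext j
        simp only [Function.update_apply]
        split_ifs <;> first | omega | simp_all
    · have : F m ≤ Q := hv'
      omega

theorem exists_boundedBy (t : Term A) : ∃ p, t.BoundedBy p := by
  induction t with
  | var i => exact ⟨_, boundedBy_var i⟩
  | one => exact ⟨_, boundedBy_one⟩
  | len => exact ⟨_, boundedBy_len⟩
  | sym f t ih => exact ⟨_, ih.choose_spec.sym f⟩
  | add s t ihs iht => exact ⟨_, ihs.choose_spec.add iht.choose_spec⟩
  | sub s t ihs iht => exact ⟨_, ihs.choose_spec.sub iht.choose_spec⟩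
  | sum s t ihs iht => exact ⟨_, ihs.choose_spec.sum iht.choose_spec⟩

/-- Whether the value of a closed term is positive can be decided in polynomial time. -/
theorem nonempty_computable [Fintype A] {α : Type} (ea : α → List A) (f : α → Bool) (t : Term A)
    (h : ∀ a, f a = true ↔ 0 < t.eval (ea a) fun _ => 0) :
    Nonempty (TM2ComputableInPolyTime ea encodeBool f) := by
  obtain ⟨p, hp⟩ := t.exists_boundedBy
  -- All variables share the empty stack `2`, hence have value 0. After the evaluation the input is
  -- erased and the result cut down to at most one entry, as the final stacks are prescribed
  -- exactly.
  refine Cmd.nonempty_computable ea f (.seq (t.compile (fun _ => 2) 3) <|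
    .seq (.loop 0 fun _ => .skip) (.cases 3 fun o => o.elim .skip fun _ =>
      .seq (.loop 3 fun _ => .skip) (.push 3 default))) 3 (4 * p + 3 * .X + 11) fun a => ?_
  set z := ea a
  obtain ⟨hv, hr⟩ := hp z (fun _ => 0) z.length le_rfl (fun _ => Nat.zero_le _)
  set v := t.eval z fun _ => 0
  have hlay : Layout z (fun _ => 0) (fun _ => 2) 3 (update (fun _ => []) 0 z) :=
    ⟨by simp, by simp, fun _ => le_rfl, fun _ => Nat.lt_succ_self 2, fun _ => by simp,
      fun j hj => Function.update_of_ne (by omega) _ _⟩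
  have r₁ := hr _ _ _ hlay
  have r₂ : Reach (A := A) (.loop 0 fun _ => .skip)
      (update (update (fun _ => []) 0 z) 3 (unary v)) (update (fun _ => []) 3 (unary v))
      (2 * z.length + 1) := by
    clear * -
    induction z with
    | nil =>
      convert (Cmd.reach_loop_nil _).mono _ using 1
      · simp
      · simp
      · simp
    | cons b l ih =>
      refine (Cmd.Reach.loop_cons (a := b) (l := l) (by simp) (Cmd.reach_skip _) ?_).mono
        (T := 1 + (2 * l.length + 1) + 1) (by simp only [List.length_cons]; omega)
      convert ih using 1
      funext j
      simp only [Function.update_apply]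
      split_ifs <;> first | omega | simp_all
  have r₃ : Reach (A := A) (.cases 3 fun o => o.elim .skip fun _ =>
      .seq (.loop 3 fun _ => .skip) (.push 3 default)) (update (fun _ => []) 3 (unary v))
      (update (fun _ => []) 3 (if f a then [default] else [])) (2 * v + 10) := by
    simp only [show (f a = true) = (0 < v) from propext (h a)]
    refine Cmd.Reach.cases (T := 2 * v + 9) ?_
    rw [Function.update_self]
    rcases v with _ | v
    · change Reach .skip _ _ _
      refine Cmd.Reach.mono ?_ (T := 1) (by omega)
      convert Cmd.reach_skip (A := A) _ using 1
      simp
    · change Reach (.seq _ _) _ _ _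
      have r := (Cmd.Reach.loop (k := 3) (b := fun _ => .skip)
        (fun n => update (fun _ => ([] : List A)) 3 (unary n)) 1 v
        (fun _ => by simp) fun m _ => by simpa using Cmd.reach_skip (A := A) _).seq
        (Cmd.reach_push 3 default _)
      refine Cmd.Reach.mono (T := v * (1 + 1) + 1 + 1) ?_ (by omega)
      convert r using 1
      · simp [Cmd.unary_succ]
      · simp
  obtain ⟨T, hT, hR⟩ := r₁.seq (r₂.seq r₃)
  refine ⟨T, hT.trans ?_, hR⟩
  simp only [Polynomial.eval_add, Polynomial.eval_mul, Polynomial.eval_ofNat, Polynomial.eval_X]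
  omega

end Term

end Terms

end WordRep

namespace WordRep

/-! ### Representable graphs on n vertices have n-uniform representing words -/

section Uniform

variable {V : Type*} [DecidableEq V]

/-- In every prefix of `W`, the letter `x` occurs as often as `y`, or once more. -/
def Leads (W : List V) (x y : V) : Prop :=
  ∀ P, P <+: W → P.count y ≤ P.count x ∧ P.count x ≤ P.count y + 1

theorem leads_cons_left {x y : V} (h : x ≠ y) (W : List V) : Leads (x :: W) x y ↔ Leads W y x := by
  constructor
  · intro H P hP
    have := H (x :: P) (List.cons_prefix_cons.2 ⟨rfl, hP⟩)
    simp only [List.count_cons_self, List.count_cons_of_ne h] at this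
    omega
  · intro H P hP
    rcases P with _ | ⟨a, P⟩
    · simp
    · obtain ⟨rfl, hP'⟩ := List.cons_prefix_cons.1 hP
      have := H P hP'
      simp only [List.count_cons_self, List.count_cons_of_ne h]
      omega

theorem not_leads_cons_right {x y : V} (h : x ≠ y) (W : List V) : ¬ Leads (y :: W) x y := by
  intro H
  have := H [y] (List.cons_prefix_cons.2 ⟨rfl, List.nil_prefix⟩)
  simp [List.count_cons_of_ne h.symm] at this

theorem leads_cons_of_ne {x y z : V} (hx : z ≠ x) (hy : z ≠ y) (W : List V) :
    Leads (z :: W) x y ↔ Leads W x y := by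
  constructor
  · intro H P hP
    have := H (z :: P) (List.cons_prefix_cons.2 ⟨rfl, hP⟩)
    simpa only [List.count_cons_of_ne hx, List.count_cons_of_ne hy] using this
  · intro H P hP
    rcases P with _ | ⟨a, P⟩
    · simp
    · obtain ⟨rfl, hP'⟩ := List.cons_prefix_cons.1 hP
      simpa only [List.count_cons_of_ne hx, List.count_cons_of_ne hy] using H P hP'

/-- Induction on the word, for both orders of the letters at once: removing a leading `x` exchanges
the roles of `x` and `y`. -/
theorem leads_iff {x y : V} (h : x ≠ y) (W : List V) :
    Leads W x y ↔ (W.filter fun z => z = x ∨ z = y).IsChain (· ≠ ·) ∧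
      (W.filter fun z => z = x ∨ z = y).head? ≠ some y := by
  induction W generalizing x y with
  | nil => simp [Leads]
  | cons z W ih =>
    by_cases hx : z = x
    · subst hx
      rw [leads_cons_left h, ih h.symm, List.filter_cons_of_pos (by simp)]
      simp only [or_comm (b := _ = z), List.isChain_cons]
      simp only [List.head?_cons, ne_eq, Option.some.injEq, h, not_false_eq_true, and_true]
      rw [and_comm]
      refine and_congr_left fun _ => ?_
      rw [Option.mem_def.symm.not]
      constructor
      · rintro H a ha rfl
        exact H ha
      · intro H ha
        exact H _ ha rfl
    · by_cases hy : z = y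
      · subst hy
        rw [List.filter_cons_of_pos (by simp)]
        simpa using not_leads_cons_right h W
      · rw [leads_cons_of_ne hx hy, ih h, List.filter_cons_of_neg (by simp [hx, hy])]

/-- Of two alternating letters, the one that occurs first leads. -/
theorem alternate_iff {x y : V} (h : x ≠ y) (W : List V) :
    Alternate W x y ↔ Leads W x y ∨ Leads W y x := by
  have key : Alternate W x y ↔ (W.filter fun z => z = x ∨ z = y).IsChain (· ≠ ·) := by
    rw [List.isChain_iff_forall_rel_of_append_cons_cons]
    constructor
    · rintro ⟨h₁, h₂⟩ a b l₁ l₂ hl rfl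
      have ha : a ∈ W.filter fun z => z = x ∨ z = y := by rw [hl]; simp
      have hi : [a, a] <:+: W.filter fun z => z = x ∨ z = y := ⟨l₁, l₂, by rw [hl]; simp⟩
      rcases (by simpa using (List.mem_filter.1 ha).2 : a = x ∨ a = y) with rfl | rfl
      exacts [h₁ hi, h₂ hi]
    · intro H
      refine ⟨fun ⟨l₁, l₂, hl⟩ => ?_, fun ⟨l₁, l₂, hl⟩ => ?_⟩
      · exact H (a := x) (b := x) (l₁ := l₁) (l₂ := l₂) (by rw [← hl]; simp) rfl
      · exact H (a := y) (b := y) (l₁ := l₁) (l₂ := l₂) (by rw [← hl]; simp) rfl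
  have hswap : (W.filter fun z => z = y ∨ z = x) = W.filter fun z => z = x ∨ z = y := by
    simp only [or_comm]
  rw [key, leads_iff h, leads_iff h.symm, hswap, ← and_or_left]
  refine (and_iff_left ?_).symm
  by_contra! hc
  rw [hc.1] at hc
  exact h (Option.some.inj hc.2).symm

omit [DecidableEq V] in
theorem prefix_append_cases {w₁ w₂ P : List V} (h : P <+: w₁ ++ w₂) :
    P <+: w₁ ∨ ∃ Q, Q <+: w₂ ∧ P = w₁ ++ Q := by
  rcases List.prefix_or_prefix_of_prefix h (List.prefix_append w₁ w₂) with h' | ⟨Q, rfl⟩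
  · exact Or.inl h'
  · exact Or.inr ⟨Q, (List.prefix_append_right_inj _).1 h, rfl⟩

section PartialOrder

variable [PartialOrder V] (G : SimpleGraph V)

/-- The numbers of occurrences of the letters in a prefix of a word are admissible, if adjacent
letters are to alternate, the smaller one first. -/
def Admissible (h : V → ℕ) : Prop :=
  ∀ x y, G.Adj x y → x ≤ y → h y ≤ h x ∧ h x ≤ h y + 1

variable {G}

/-- Among the letters still needed, take those of least count, and among these a minimal one in the
order. If an edge forbade this letter, admissibility of `h'` would make the other end needed as
well, with a smaller count, or with the same count and smaller in the order. -/
theorem Admissible.exists_step [Fintype V] {h h' : V → ℕ} (hh : Admissible G h)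
    (hh' : Admissible G h') (hne : ∃ u, h u < h' u) :
    ∃ u, h u < h' u ∧ Admissible G fun v => h v + [u].count v := by
  classical
  obtain ⟨u₀, hu₀⟩ := hne
  obtain ⟨m, hm, hmin⟩ := (Finset.univ.filter fun u => h u < h' u).exists_min_image h
    ⟨u₀, by simpa using hu₀⟩
  obtain ⟨u, hu, humin⟩ := (Finset.univ.filter fun u => h u < h' u ∧ h u = h m).exists_minimal
    ⟨m, by simpa using hm⟩
  simp only [Finset.mem_filter, Finset.mem_univ, true_and] at hu humin hm hmin
  refine ⟨u, hu.1, fun x y hxy hle' => ?_⟩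
  have e : ∀ v, [u].count v = if u = v then 1 else 0 := fun v => by
    simp [List.count_singleton]
  have h₁ := hh x y hxy hle'
  have h₂ := hh' x y hxy hle'
  simp only [e]
  by_cases hux : u = x
  · have huy : u ≠ y := fun h => hxy.ne (hux.symm.trans h)
    subst hux
    rw [if_pos rfl, if_neg huy]
    refine ⟨by omega, ?_⟩
    by_contra hc
    have := hmin y (by omega)
    omega
  · by_cases huy : u = y
    · subst huy
      rw [if_pos rfl, if_neg hux]
      refine ⟨?_, by omega⟩
      by_contra hc
      have := humin (y := x) ⟨by omega, by omega⟩ hle'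
      exact hxy.ne (le_antisymm hle' this)
    · rw [if_neg hux, if_neg huy]
      exact h₁

theorem Admissible.exists_word [Fintype V] {h h' : V → ℕ} (hh : Admissible G h)
    (hh' : Admissible G h') (hle : h ≤ h') :
    ∃ w : List V, (∀ u, h u + w.count u = h' u) ∧
      ∀ P, P <+: w → Admissible G fun u => h u + P.count u := by
  induction hn : ∑ u, (h' u - h u) generalizing h with
  | zero =>
    have : ∀ u, h u = h' u := fun u => by
      have h₁ := (Finset.sum_eq_zero_iff.1 hn) u (Finset.mem_univ u)
      have h₂ : h u ≤ h' u := hle u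
      omega
    refine ⟨[], by simpa using this, fun P hP => ?_⟩
    rw [List.prefix_nil.1 hP]
    simpa using hh
  | succ n ih =>
    have hne : ∃ u, h u < h' u := by
      by_contra! hc
      have : ∑ u, (h' u - h u) = 0 := Finset.sum_eq_zero fun u _ => by have := hc u; omega
      omega
    obtain ⟨u, hu, hadm⟩ := hh.exists_step hh' hne
    have e : ∀ v, [u].count v = if u = v then 1 else 0 := fun v => by
      simp [List.count_singleton]
    obtain ⟨w, hw, hP⟩ := ih hadm
      (fun v => by
        have : h v ≤ h' v := hle v
        simp only [e]
        split_ifs with huv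
        · subst huv; omega
        · omega)
      (by
        have h₁ : ∑ v, (h' v - h v) = ∑ v, ((h' v - (h v + [u].count v)) + [u].count v) := by
          refine Finset.sum_congr rfl fun v _ => ?_
          have : h v ≤ h' v := hle v
          simp only [e]
          split_ifs with huv
          · subst huv; omega
          · omega
        have h₂ : ∑ v, [u].count v = 1 := by simp [e]
        rw [Finset.sum_add_distrib, h₂] at h₁
        omega)
    have hc : ∀ (P : List V) v, (u :: P).count v = [u].count v + P.count v := fun P v => by
      rw [← List.singleton_append, List.count_append]
    refine ⟨u :: w, fun v => by rw [hc w, ← add_assoc, hw], fun P hPw => ?_⟩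
    rcases P with _ | ⟨a, P⟩
    · simpa using hh
    · obtain ⟨ha, hPw'⟩ := List.cons_prefix_cons.1 hPw
      rw [ha]
      have e' : (fun v => h v + (u :: P).count v) = fun v => h v + [u].count v + P.count v :=
        funext fun v => by rw [hc P, add_assoc]
      rw [e']
      exact hP P hPw'

/-- Concatenating the words between consecutive members of a chain gives a word whose prefixes
realise all of them. -/
theorem Admissible.exists_word_of_chain [Fintype V] {h' : V → ℕ} (hh' : Admissible G h')
    (l : List (V → ℕ)) {h : V → ℕ} (hh : Admissible G h) (hl : ∀ g ∈ l, Admissible G g)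
    (hle : ∀ g ∈ l, g ≤ h') (hhh : h ≤ h') (hc : (h :: l).Pairwise (· ≤ ·)) :
    ∃ w : List V, (∀ u, h u + w.count u = h' u) ∧
      (∀ P, P <+: w → Admissible G fun u => h u + P.count u) ∧
      ∀ g ∈ l, ∃ P, P <+: w ∧ ∀ u, h u + P.count u = g u := by
  induction l generalizing h with
  | nil =>
    obtain ⟨w, h₁, h₂⟩ := hh.exists_word hh' hhh
    exact ⟨w, h₁, h₂, by simp⟩
  | cons g l ih =>
    simp only [List.forall_mem_cons] at hl hle
    rw [List.pairwise_cons] at hc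
    obtain ⟨w₁, h₁, h₂⟩ := hh.exists_word hl.1 (hc.1 g (by simp))
    obtain ⟨w₂, h₃, h₄, h₅⟩ := ih hl.1 hl.2 hle.2 hle.1 hc.2
    have key : ∀ (Q : List V) u, h u + (w₁ ++ Q).count u = g u + Q.count u := fun Q u => by
      rw [List.count_append, ← add_assoc, h₁]
    refine ⟨w₁ ++ w₂, fun u => by rw [key, h₃], fun P hP => ?_, ?_⟩
    · rcases prefix_append_cases hP with hP | ⟨Q, hQ, rfl⟩
      · exact h₂ P hP
      · simpa only [key] using h₄ Q hQ
    · rw [List.forall_mem_cons]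
      refine ⟨⟨w₁, List.prefix_append _ _, h₁⟩, fun g' hg' => ?_⟩
      obtain ⟨Q, hQ, hQ'⟩ := h₅ g' hg'
      exact ⟨w₁ ++ Q, (List.prefix_append_right_inj _).2 hQ, fun u => by rw [key, hQ']⟩

variable (G) in
open Classical in
/-- The numbers of occurrences, up to a constant, in a prefix that ends before an occurrence of `v`
that is as late as possible. -/
noncomputable def lateProfile (v u : V) : ℕ :=
  if v ≤ u then 0 else if u ≤ v ∧ ¬ G.Adj u v then 2 else 1

variable (G) in
/-- Adjacent letters are comparable, and any two letters between adjacent letters are adjacent. -/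
structure IsSemiTransitive : Prop where
  comparable : ∀ {x y}, G.Adj x y → x ≤ y ∨ y ≤ x
  adj : ∀ {a b c d}, a ≤ b → b ≤ c → c ≤ d → G.Adj a d → b ≠ c → G.Adj b c

omit [DecidableEq V] in
-- An edge `x ≤ y` could only fail with values 2, 0 or 1, 2. In the first case `x ≤ v ≤ y` forces
-- `x`, `v` to be adjacent; in the second `x ≤ y ≤ v` with `x`, `v` adjacent forces `y`, `v` to be
-- adjacent. Both contradict the value 2.
theorem IsSemiTransitive.admissible (hG : IsSemiTransitive G) (v : V) (c : ℕ) :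
    Admissible G fun u => lateProfile G v u + c := by
  intro x y hxy hle
  simp only [lateProfile]
  by_cases hvx : v ≤ x
  · simp [hvx, hvx.trans hle]
  · rw [if_neg hvx]
    by_cases hvy : v ≤ y
    · have hx : ¬ (x ≤ v ∧ ¬ G.Adj x v) := fun h =>
        h.2 (hG.adj le_rfl h.1 hvy hxy fun h => hvx h.ge)
      rw [if_pos hvy, if_neg hx]
      omega
    · rw [if_neg hvy]
      split_ifs with hy hx hx
      · omega
      · refine absurd ?_ hx
        exact ⟨hle.trans hy.1, fun h => hy.2 (hG.adj hle hy.1 le_rfl h fun h => hvy h.ge)⟩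
      · omega
      · omega

omit [DecidableEq V] in
theorem IsSemiTransitive.lateProfile_mono (hG : IsSemiTransitive G) {v w : V} (hvw : v ≤ w)
    (u : V) : lateProfile G v u ≤ lateProfile G w u := by
  simp only [lateProfile]
  by_cases hvu : v ≤ u
  · simp [hvu]
  · rw [if_neg hvu, if_neg fun h => hvu (hvw.trans h)]
    split_ifs with h₁ h₂ h₂
    · omega
    · refine absurd ?_ h₂
      exact ⟨h₁.1.trans hvw, fun h => h₁.2 (hG.adj le_rfl h₁.1 hvw h fun h => hvu h.ge)⟩
    · omega
    · omega

/-- The numbering of a linear extension would be a valid shift, but with the late profile it can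
exceed n by one. If some `x₀ < y₀` exists, giving one such pair a common number saves one; `y₀` is
the first element above `x₀` in the extension, so that monotonicity survives. In an antichain the
value 2 does not occur and nothing has to be saved. -/
theorem exists_weaklyMonotone [Fintype V] : ∃ f : V → ℕ, Monotone f ∧
    (∀ x y, f x = f y → x ≤ y ∨ y ≤ x) ∧
    ∀ v u, lateProfile G v u + f v ≤ Fintype.card V := by
  classical
  obtain ⟨e, he, hinj, hlt⟩ : ∃ e : V → ℕ, StrictMono e ∧ Function.Injective e ∧
      ∀ v, e v < Fintype.card V := by
    let _ : Fintype (LinearExtension V) := inferInstanceAs (Fintype V)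
    let i := Fintype.orderIsoFinOfCardEq (LinearExtension V) (k := Fintype.card V) rfl
    refine ⟨fun v => i.symm (toLinearExtension v), fun x y hxy => ?_,
      fun x y hxy => i.symm.injective (Fin.ext hxy), fun v => Fin.is_lt _⟩
    have h₁ : toLinearExtension x ≤ toLinearExtension y := toLinearExtension.monotone hxy.le
    have h₂ : toLinearExtension x ≠ toLinearExtension y := fun h => hxy.ne h
    exact i.symm.strictMono (lt_of_le_of_ne h₁ h₂)
  by_cases hlt' : ∃ x y : V, x < y
  · obtain ⟨x₀, hx₀⟩ := hlt'
    obtain ⟨y₀, hy₀, hmin⟩ := (Finset.univ.filter fun y => x₀ < y).exists_min_image e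
      ⟨hx₀.choose, by simpa using hx₀.choose_spec⟩
    simp only [Finset.mem_filter, Finset.mem_univ, true_and] at hy₀ hmin
    have hxy₀ := he hy₀
    -- Without `x₀` the others are renumbered consecutively, and `x₀` receives the new number of
    -- `y₀`.
    let f : V → ℕ := fun u => if u = x₀ then e y₀ - 1 else if e u < e x₀ then e u else e u - 1
    have hf₀ : f x₀ = e y₀ - 1 := if_pos rfl
    have hf : ∀ u, u ≠ x₀ → e u < e x₀ ∧ f u = e u ∨ e x₀ < e u ∧ f u = e u - 1 := fun u hu => by
      have := hinj.ne hu
      rcases lt_or_gt_of_ne this with h | h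
      · exact Or.inl ⟨h, by simp only [f, hu, h, if_true, if_false]⟩
      · exact Or.inr ⟨h, by simp only [f, hu, h.not_gt, if_false]⟩
    refine ⟨f, ?_, ?_, fun v u => ?_⟩
    · intro x y hle
      rcases hle.eq_or_lt with rfl | hxy
      · exact le_rfl
      have h₁ := he hxy
      by_cases hx : x = x₀
      · subst hx
        have h₂ := hmin y hxy
        rcases hf y hxy.ne' with h | h <;> omega
      · by_cases hy : y = x₀
        · subst hy
          rcases hf x hx with h | h <;> omega
        · rcases hf x hx with h | h <;> rcases hf y hy with h' | h' <;> omega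
    · have key : ∀ y, f x₀ = f y → x₀ ≤ y := fun y h => by
        by_cases hy : y = x₀
        · exact hy.ge
        · have : y = y₀ := hinj (by rcases hf y hy with h' | h' <;> omega)
          exact this ▸ hy₀.le
      intro x y hxy
      by_cases hx : x = x₀
      · subst hx
        exact Or.inl (key y hxy)
      · by_cases hy : y = x₀
        · subst hy
          exact Or.inr (key x hxy.symm)
        · have : x = y := hinj (by
            rcases hf x hx with h | h <;> rcases hf y hy with h' | h' <;> omega)
          exact Or.inl this.le
    · have h₁ : lateProfile G v u ≤ 2 := by
        unfold lateProfile
        split_ifs <;> omega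
      have h₂ := hlt v
      have h₃ := hlt y₀
      by_cases hv : v = x₀
      · subst hv
        omega
      · rcases hf v hv with h | h <;> omega
  · push Not at hlt'
    have heq : ∀ {x y : V}, x ≤ y → x = y := fun {x y} h => h.eq_or_lt.resolve_right (hlt' x y)
    refine ⟨e, he.monotone, fun x y h => Or.inl (hinj h).le, fun v u => ?_⟩
    have h₁ : lateProfile G v u ≤ 1 := by
      unfold lateProfile
      split_ifs with h₁ h₂
      · omega
      · exact absurd (heq h₂.1).ge h₁
      · omega
    have h₂ := hlt v
    omega

theorem IsSemiTransitive.exists_uniform [Fintype V] (hG : IsSemiTransitive G) :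
    ∃ W : List V, IsUniform (Fintype.card V) W ∧ Represents W G := by
  classical
  obtain ⟨f, hf, hf', hf''⟩ := exists_weaklyMonotone (G := G)
  let φ : V → V → ℕ := fun v u => lateProfile G v u + f v
  have htotal : ∀ v w, φ v ≤ φ w ∨ φ w ≤ φ v := by
    -- A drop of the late profile from 2 to 0 would mean `w ≤ u ≤ v`, against monotonicity of `f`. A
    -- drop by 1 is compensated by the larger shift.
    have key : ∀ v w, f v < f w → φ v ≤ φ w := by
      intro v w h u
      have hwv : ¬ w ≤ v := fun h' => h.not_ge (hf h')
      have : lateProfile G v u ≤ lateProfile G w u + 1 := by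
        by_cases hwu : w ≤ u
        · have huv : ¬ u ≤ v := fun h => hwv (hwu.trans h)
          simp only [lateProfile, huv, false_and, if_false]
          split_ifs <;> omega
        · simp only [lateProfile, hwu, if_false]
          split_ifs <;> omega
      simp only [φ]
      omega
    intro v w
    rcases lt_trichotomy (f v) (f w) with h | h | h
    · exact Or.inl (key v w h)
    · rcases hf' v w h with h' | h'
      · exact Or.inl fun u => Nat.add_le_add (hG.lateProfile_mono h' u) h.le
      · exact Or.inr fun u => Nat.add_le_add (hG.lateProfile_mono h' u) h.ge
    · exact Or.inr (key w v h)
  let l : List V := Finset.univ.toList.insertionSort fun v w => φ v ≤ φ w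
  have hl : l.Pairwise fun v w => φ v ≤ φ w := by
    have : Std.Total fun v w => φ v ≤ φ w := ⟨htotal⟩
    have : IsTrans V fun v w => φ v ≤ φ w := ⟨fun _ _ _ => le_trans⟩
    exact List.pairwise_insertionSort _ _
  have hmem : ∀ v, v ∈ l := fun v => by simp [l]
  obtain ⟨W, hW, hP, hl'⟩ := Admissible.exists_word_of_chain (G := G) (h := fun _ => 0)
    (h' := fun _ => Fintype.card V) (fun _ _ _ _ => by simp) (l.map φ) (fun _ _ _ _ => by simp)
    (by
      simp only [List.mem_map, forall_exists_index, and_imp, forall_apply_eq_imp_iff₂]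
      exact fun v _ => hG.admissible v (f v))
    (by
      simp only [List.mem_map, forall_exists_index, and_imp, forall_apply_eq_imp_iff₂]
      exact fun v _ => hf'' v)
    (fun _ => Nat.zero_le _)
    (List.pairwise_cons.2 ⟨fun _ _ _ => Nat.zero_le _, List.pairwise_map.2 hl⟩)
  simp only [zero_add] at hW hP hl'
  have hφ : ∀ v, ∃ P, P <+: W ∧ ∀ u, P.count u = lateProfile G v u + f v := fun v =>
    hl' (φ v) (List.mem_map_of_mem (hmem v))
  -- For non-adjacent letters with `x ≤ y`, the profile of `y` puts `x` two ahead; otherwise the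
  -- profile of `x` puts `y` ahead of `x`.
  have key : ∀ x y, x ≠ y → Leads W x y → G.Adj x y := by
    intro x y hxy hlead
    by_contra hadj
    obtain ⟨P, hPW, hcount⟩ := hφ x
    obtain ⟨Q, hQW, hcount'⟩ := hφ y
    have h₁ := hlead P hPW
    have h₂ := hlead Q hQW
    rw [hcount, hcount] at h₁
    rw [hcount', hcount'] at h₂
    have hadj' : ¬ G.Adj y x := fun h => hadj h.symm
    simp only [lateProfile, le_refl, if_true, hadj, hadj', not_false_eq_true, and_true] at h₁ h₂
    by_cases hle : x ≤ y
    · have hle' : ¬ y ≤ x := fun h => hxy (le_antisymm hle h)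
      simp only [hle, hle', if_true, if_false] at h₂
      omega
    · simp only [hle, if_false] at h₁
      split_ifs at h₁ <;> omega
  refine ⟨W, hW, fun v => ?_, fun x y hxy => ?_⟩
  · rw [← List.count_pos_iff, hW]
    exact Fintype.card_pos_iff.2 ⟨v⟩
  · rw [alternate_iff hxy]
    constructor
    · intro hadj
      refine (hG.comparable hadj).imp (fun h P hPW => ?_) (fun h P hPW => ?_)
      · exact hP P hPW x y hadj h
      · exact hP P hPW y x hadj.symm h
    · rintro (h | h)
      · exact key x y hxy h
      · exact (key y x hxy.symm h).symm

end PartialOrder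

/-- A graph on `n` vertices that is representable is represented by an `n`-uniform word. -/
theorem IsRepresentable.exists_uniform [Fintype V] {G : SimpleGraph V} (h : IsRepresentable G) :
    ∃ W : List V, IsUniform (Fintype.card V) W ∧ Represents W G := by
  obtain ⟨W, hW, hG⟩ := h
  let order : PartialOrder V :=
    { le := fun x y => ∀ P, P <+: W → P.count y ≤ P.count x
      le_refl := fun _ _ _ => le_rfl
      le_trans := fun _ _ _ h₁ h₂ P hP => (h₂ P hP).trans (h₁ P hP)
      le_antisymm := fun x y h₁ h₂ => by
        by_contra hxy
        -- The two counts would agree in every prefix, but appending this `x` to `T` changes only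
        -- one of them.
        obtain ⟨T, R, hT⟩ := List.append_of_mem (hW x)
        have hp₁ : T <+: W := ⟨_, hT.symm⟩
        have hp₂ : T ++ [x] <+: W := ⟨R, by simp [hT]⟩
        have h₃ := h₁ T hp₁
        have h₄ := h₂ T hp₁
        have h₅ := h₂ (T ++ [x]) hp₂
        simp only [List.count_append, List.count_cons_self, List.count_nil,
          List.count_cons_of_ne hxy] at h₅
        omega }
  refine @IsSemiTransitive.exists_uniform V _ order G _ ⟨?_, ?_⟩
  · intro x y hxy
    have hxy' := (hG x y hxy.ne).1 hxy
    rw [alternate_iff hxy.ne] at hxy'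
    exact hxy'.imp (fun h P hP => (h P hP).1) (fun h P hP => (h P hP).1)
  · intro a b c d hab hbc hcd had hne
    rw [hG _ _ hne, alternate_iff hne]
    have hd := (hG a d had.ne).1 had
    rw [alternate_iff had.ne] at hd
    left
    intro P hP
    -- The counts of `b` and `c` lie between those of `d` and `a`, which differ by at most one.
    have h₁ : P.count b ≤ P.count a := hab P hP
    have h₂ : P.count c ≤ P.count b := hbc P hP
    have h₃ : P.count d ≤ P.count c := hcd P hP
    refine ⟨h₂, ?_⟩
    rcases hd with hd | hd <;> have := hd P hP <;> omega

end Uniform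

end WordRep

namespace WordRep

/-! ### Bounded formulas as terms -/

section Formulas

namespace Term

variable {A : Type}

/-- A term is regarded as a formula, which holds if the value is positive. -/
def Holds (z : List A) (t : Term A) (ρ : ℕ → ℕ) : Prop :=
  0 < t.eval z ρ

/-- Negation. -/
def not (t : Term A) : Term A := sub one t

/-- Conjunction. -/
def and (s t : Term A) : Term A := not (add (not s) (not t))

/-- Disjunction. -/
def or (s t : Term A) : Term A := add s t

/-- Implication. -/
def imp (s t : Term A) : Term A := or (not s) t

/-- Equivalence. -/
def iff (s t : Term A) : Term A := and (imp s t) (imp t s)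

/-- Comparison of numbers. -/
def le (s t : Term A) : Term A := not (sub s t)

/-- Equality of numbers. -/
def eq (s t : Term A) : Term A := and (le s t) (le t s)

/-- Existential quantification over the numbers below a bound. -/
def ex (b t : Term A) : Term A := sum b t

/-- Universal quantification over the numbers below a bound. -/
def all (b t : Term A) : Term A := not (sum b (not t))

/-- The number of the numbers below a bound for which a formula holds. -/
def count (b t : Term A) : Term A := sum b (not (not t))

variable (z : List A) (s t : Term A) (ρ : ℕ → ℕ)

@[simp]
theorem holds_not : Holds z (not t) ρ ↔ ¬ Holds z t ρ := by
  simp only [Holds, not, eval]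
  omega

@[simp]
theorem holds_and : Holds z (and s t) ρ ↔ Holds z s ρ ∧ Holds z t ρ := by
  simp only [Holds, and, not, eval]
  omega

@[simp]
theorem holds_or : Holds z (or s t) ρ ↔ Holds z s ρ ∨ Holds z t ρ := by
  simp only [Holds, or, eval]
  omega

@[simp]
theorem holds_imp : Holds z (imp s t) ρ ↔ (Holds z s ρ → Holds z t ρ) := by
  simp only [imp, holds_or, holds_not, imp_iff_not_or]

@[simp]
theorem holds_iff : Holds z (iff s t) ρ ↔ (Holds z s ρ ↔ Holds z t ρ) := by
  simp only [iff, holds_and, holds_imp, iff_iff_implies_and_implies]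

@[simp]
theorem holds_le : Holds z (le s t) ρ ↔ s.eval z ρ ≤ t.eval z ρ := by
  simp only [Holds, le, not, eval]
  omega

@[simp]
theorem holds_eq : Holds z (eq s t) ρ ↔ s.eval z ρ = t.eval z ρ := by
  simp only [eq, holds_and, holds_le, le_antisymm_iff]

@[simp]
theorem holds_ex : Holds z (ex s t) ρ ↔ ∃ p < s.eval z ρ, Holds z t (scons p ρ) := by
  simp [Holds, ex, eval, Finset.sum_pos_iff]

@[simp]
theorem holds_all : Holds z (all s t) ρ ↔ ∀ p < s.eval z ρ, Holds z t (scons p ρ) := by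
  have : all s t = not (ex s (not t)) := rfl
  simp [this]

@[simp]
theorem holds_sym (f : A → Bool) :
    Holds z (sym f t) ρ ↔ z[t.eval z ρ]?.any f = true := by
  simp only [Holds, eval]
  split_ifs with h <;> simp [h]

open Classical in
@[simp]
theorem eval_count : (count s t).eval z ρ =
    ((Finset.range (s.eval z ρ)).filter fun p => Holds z t (scons p ρ)).card := by
  rw [Finset.card_filter]
  refine Finset.sum_congr rfl fun p _ => ?_
  by_cases h : Holds z t (scons p ρ)
  · rw [if_pos h]
    simp only [Holds] at h
    simp only [not, eval]
    omega
  · rw [if_neg h]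
    simp only [Holds] at h
    simp only [not, eval]
    omega

end Term

end Formulas

/-! ### The certificate relation as a bounded formula -/

section Certificates

open Term

/-- Some entry at position `p` has the property `f`. -/
def At {A : Type} (f : A → Bool) (z : List A) (p : ℕ) : Prop :=
  z[p]?.any f = true

/-- The entry is the bit `b` of the first string. -/
def isFst (b : Bool) : Bool ⊕ Bool → Bool := fun s => s = Sum.inl b

/-- The entry is the bit `b` of the second string. -/
def isSnd (b : Bool) : Bool ⊕ Bool → Bool := fun s => s = Sum.inr b

/-- The code of the letter `i` in the second string ends at position `p`. -/
def Occ (z : List (Bool ⊕ Bool)) (p i : ℕ) : Prop :=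
  -- A truncated difference points to position 0. In the application this lies in the nonempty first
  -- string, which ends a run of ones in the second.
  At (isSnd false) z p ∧ (∀ q < i, At (isSnd true) z (p - 1 - q)) ∧
    ¬ At (isSnd true) z (p - 1 - i)

open Classical in
/-- The number of occurrences of the letter `i` that end before position `q`. -/
noncomputable def occCount (z : List (Bool ⊕ Bool)) (q i : ℕ) : ℕ :=
  ((Finset.range q).filter fun p => Occ z p i).card

open Classical in
/-- The length of the first string. -/
noncomputable def fstLength (z : List (Bool ⊕ Bool)) : ℕ :=
  ((Finset.range z.length).filter fun p => At Sum.isLeft z p).card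

/-- The code of the letter `i` is a leading letter of `i`, `j` at all positions. -/
def LeadsAt (z : List (Bool ⊕ Bool)) (i j : ℕ) : Prop :=
  ∀ q < z.length + 1, occCount z q j ≤ occCount z q i ∧ occCount z q i ≤ occCount z q j + 1

/-- The string `z` consists of the encoding of a graph on `n` vertices and a certificate. -/
def IsCertified (z : List (Bool ⊕ Bool)) (n : ℕ) : Prop :=
  ((∀ q < n, At (isFst true) z q) ∧ At (isFst false) z n ∧
    fstLength z = n + 1 + n * n) ∧
  (∀ i < n, ¬ At (isFst true) z (n + 1 + i * n + i)) ∧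
  (∀ i < n, ∀ j < n, At (isFst true) z (n + 1 + i * n + j) →
    At (isFst true) z (n + 1 + j * n + i)) ∧
  ¬ At (isSnd true) z (z.length - 1) ∧
  -- The bound on `i` loses nothing, as the code of a letter `i` is longer than `i`.
  (∀ i < z.length, n ≤ i → occCount z z.length i = 0) ∧
  -- The condition `1 ≤ k` says that every vertex occurs; inside the quantifier it is void for the
  -- empty graph.
  (∃ k < n + 1, ∀ i < n, occCount z z.length i = k ∧ 1 ≤ k) ∧
  ∀ i < n, ∀ j < n, i ≠ j →
    (At (isFst true) z (n + 1 + i * n + j) ↔ LeadsAt z i j ∨ LeadsAt z j i)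

section Terms

/-- The entry of the adjacency matrix with indices `i`, `j`, for the graph on `n` vertices. -/
def adjTerm (n i j : ℕ) : Term (Bool ⊕ Bool) :=
  -- A sum of constant summands serves as a product; its binder shifts the index `n` by one.
  sym (isFst true) (add (add (add (var n) one) (sum (var i) (var (n + 1)))) (var j))

/-- The term for `occCount`. -/
def occCountTerm (b : Term (Bool ⊕ Bool)) (i : ℕ) : Term (Bool ⊕ Bool) :=
  count b <| and (sym (isSnd false) (var 0)) <|
    and (all (var (i + 1)) (sym (isSnd true) (sub (sub (var 1) one) (var 0))))
      (not (sym (isSnd true) (sub (sub (var 0) one) (var (i + 1)))))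

/-- The term for `fstLength`. -/
def fstLengthTerm : Term (Bool ⊕ Bool) :=
  count len (sym Sum.isLeft (var 0))

/-- The formula for `LeadsAt`. -/
def leadsTerm (i j : ℕ) : Term (Bool ⊕ Bool) :=
  all (add len one) <| and (le (occCountTerm (var 0) (j + 1)) (occCountTerm (var 0) (i + 1)))
    (le (occCountTerm (var 0) (i + 1)) (add (occCountTerm (var 0) (j + 1)) one))

/-- The formula for `IsCertified`. -/
def certifiedTerm : Term (Bool ⊕ Bool) :=
  and (and (all (var 0) (sym (isFst true) (var 0))) <|
    and (sym (isFst false) (var 0))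
      (eq fstLengthTerm (add (add (var 0) one) (sum (var 0) (var 1))))) <|
  and (all (var 0) (not (adjTerm 1 0 0))) <|
  and (all (var 0) (all (var 1) (imp (adjTerm 2 1 0) (adjTerm 2 0 1)))) <|
  and (not (sym (isSnd true) (sub len one))) <|
  and (all len (imp (le (var 1) (var 0)) (eq (occCountTerm len 0) (sub one one)))) <|
  and (ex (add (var 0) one) (all (var 1)
    (and (eq (occCountTerm len 0) (var 1)) (le one (var 1))))) <|
  all (var 0) (all (var 1) (imp (not (eq (var 1) (var 0)))
    (iff (adjTerm 2 1 0) (or (leadsTerm 1 0) (leadsTerm 0 1)))))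

variable (z : List (Bool ⊕ Bool)) (ρ : ℕ → ℕ)

theorem holds_adjTerm (n i j : ℕ) : Holds z (adjTerm n i j) ρ ↔
    At (isFst true) z (ρ n + 1 + ρ i * ρ n + ρ j) := by
  simp [adjTerm, eval, scons, At]

theorem eval_occCountTerm (b : Term (Bool ⊕ Bool)) (i : ℕ) :
    (occCountTerm b i).eval z ρ = occCount z (b.eval z ρ) (ρ i) := by
  simp only [occCountTerm, eval_count, occCount]
  congr 1
  ext p
  simp [eval, scons, At, Occ]

theorem eval_fstLengthTerm : fstLengthTerm.eval z ρ = fstLength z := by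
  simp only [fstLengthTerm, eval_count, fstLength]
  congr 1
  ext p
  simp only [Finset.mem_filter]
  simp [eval, scons, At]

theorem holds_leadsTerm (i j : ℕ) : Holds z (leadsTerm i j) ρ ↔ LeadsAt z (ρ i) (ρ j) := by
  simp [leadsTerm, eval_occCountTerm, LeadsAt, eval, scons]

theorem holds_certifiedTerm : Holds z certifiedTerm ρ ↔ IsCertified z (ρ 0) := by
  simp [certifiedTerm, holds_leadsTerm, holds_adjTerm, eval_fstLengthTerm, eval_occCountTerm,
    IsCertified, eval, scons, At]

end Terms

end Certificates

end WordRep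

namespace WordRep

/-! ### Reading graphs and words from bit strings -/

section Encodings

theorem at_append_left {A : Type} {f : A → Bool} {z w : List A} {p : ℕ} (hp : p < z.length) :
    At f (z ++ w) p ↔ At f z p := by
  rw [At, At, List.getElem?_append_left hp]

theorem at_append_right {A : Type} {f : A → Bool} {z w : List A} {p : ℕ} :
    At f (z ++ w) (z.length + p) ↔ At f w p := by
  rw [At, At, List.getElem?_append_right (Nat.le_add_right _ _), Nat.add_sub_cancel_left]

theorem at_isFst_iff {b : Bool} {x y : List Bool} {p : ℕ} :
    At (isFst b) (x.map Sum.inl ++ y.map Sum.inr) p ↔ x[p]? = some b := by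
  rcases lt_or_ge p x.length with hp | hp
  · rw [at_append_left (by simpa using hp)]
    simp [At, isFst, hp]
  · obtain ⟨q, rfl⟩ := Nat.exists_eq_add_of_le hp
    rw [← List.length_map (as := x) (Sum.inl : Bool → Bool ⊕ Bool), at_append_right]
    simp [At, isFst, Option.any_map]

theorem fstLength_eq (x y : List Bool) :
    fstLength (x.map Sum.inl ++ y.map Sum.inr) = x.length := by
  have : ∀ p, p < (x.map Sum.inl ++ y.map Sum.inr).length ∧
      At Sum.isLeft (x.map Sum.inl ++ y.map Sum.inr) p ↔ p < x.length := by
    intro p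
    rcases lt_or_ge p x.length with hp | hp
    · rw [at_append_left (by simpa using hp)]
      simp [At, hp]
      omega
    · obtain ⟨q, rfl⟩ := Nat.exists_eq_add_of_le hp
      rw [← List.length_map (as := x) (Sum.inl : Bool → Bool ⊕ Bool), at_append_right]
      simp [At, Option.any_map]
  rw [fstLength, ← Finset.card_range x.length]
  congr 1
  ext p
  simp only [Finset.mem_filter, Finset.mem_range, this]

theorem divNat_mk {n : ℕ} (i j : Fin n) (h : (i : ℕ) * n + j < n * n) :
    (⟨i * n + j, h⟩ : Fin (n * n)).divNat = i := by
  ext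
  have hn : 0 < n := i.pos
  change ((i : ℕ) * n + j) / n = i
  rw [Nat.add_comm, Nat.add_mul_div_right _ _ hn, Nat.div_eq_of_lt j.2, Nat.zero_add]

theorem modNat_mk {n : ℕ} (i j : Fin n) (h : (i : ℕ) * n + j < n * n) :
    (⟨i * n + j, h⟩ : Fin (n * n)).modNat = j := by
  ext
  change ((i : ℕ) * n + j) % n = j
  rw [Nat.add_comm, Nat.add_mul_mod_self_right, Nat.mod_eq_of_lt j.2]

open Classical in
theorem encodeGraph_eq {n : ℕ} (G : SimpleGraph (Fin n)) :
    encodeGraph G = List.replicate n true ++ false ::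
      List.ofFn fun k : Fin (n * n) => decide (G.Adj k.divNat k.modNat) := by
  rw [encodeGraph, List.ofFn_mul, List.flatMap_def]
  simp only [List.ofFn_eq_map, divNat_mk, modNat_mk]

theorem mul_add_lt {n : ℕ} (i j : Fin n) : (i : ℕ) * n + j < n * n := by
  have h₁ : ((i : ℕ) + 1) * n ≤ n * n := Nat.mul_le_mul_right n i.2
  have h₂ := j.2
  rw [Nat.succ_mul] at h₁
  omega

open Classical in
theorem getElem?_encodeGraph {n : ℕ} (G : SimpleGraph (Fin n)) (i j : Fin n) :
    (encodeGraph G)[n + 1 + i * n + j]? = some (decide (G.Adj i j)) := by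
  rw [encodeGraph_eq, List.getElem?_append_right (by simp; omega), List.length_replicate,
    show n + 1 + i * n + j - n = i * n + j + 1 by omega, List.getElem?_cons_succ,
    List.getElem?_ofFn, dif_pos (mul_add_lt i j), divNat_mk, modNat_mk]

theorem getElem?_encodeGraph_of_lt {n : ℕ} (G : SimpleGraph (Fin n)) {q : ℕ} (hq : q < n) :
    (encodeGraph G)[q]? = some true := by
  rw [encodeGraph_eq, List.getElem?_append_left (by simpa using hq)]
  simp [hq]

theorem getElem?_encodeGraph_self {n : ℕ} (G : SimpleGraph (Fin n)) :
    (encodeGraph G)[n]? = some false := by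
  rw [encodeGraph_eq, List.getElem?_append_right (by simp)]
  simp

theorem length_encodeGraph {n : ℕ} (G : SimpleGraph (Fin n)) :
    (encodeGraph G).length = n + 1 + n * n := by
  classical
  simp [encodeGraph_eq]
  omega

/-- The encoding of words, for words over the natural numbers. -/
def encodeNatWord (W : List ℕ) : List Bool :=
  W.flatMap fun i => List.replicate i true ++ [false]

theorem encodeWord_eq {n : ℕ} (W : List (Fin n)) :
    encodeWord W = encodeNatWord (W.map Fin.val) := by
  have h : (do let a ← W; pure (a : ℕ)) = W.map Fin.val := by
    rw [List.bind_eq_flatMap, List.map_eq_flatMap]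
    rfl
  rw [encodeWord, encodeNatWord, ← h]

/-- Decoding from the back: a leading zero is a new letter 0, and a leading one increments the first
letter of the rest. -/
theorem exists_encodeNatWord (y : List Bool) (hy : ∀ y', y ≠ y' ++ [true]) :
    ∃ W, encodeNatWord W = y := by
  induction y with
  | nil => exact ⟨[], rfl⟩
  | cons b t ih =>
    obtain ⟨W, rfl⟩ := ih fun y' h => hy (b :: y') (by rw [h]; rfl)
    rcases b with _ | _
    · exact ⟨0 :: W, rfl⟩
    · rcases W with _ | ⟨i, W⟩
      · exact absurd rfl (hy [])
      · exact ⟨(i + 1) :: W, rfl⟩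

theorem lt_length_encodeNatWord {W : List ℕ} {i : ℕ} (h : i ∈ W) :
    i < (encodeNatWord W).length := by
  obtain ⟨s, t, rfl⟩ := List.append_of_mem h
  simp [encodeNatWord]
  omega

theorem Occ.append_iff {z w : List (Bool ⊕ Bool)} {p i : ℕ} (hp : p < z.length) :
    Occ (z ++ w) p i ↔ Occ z p i := by
  have : ∀ q, p - 1 - q < z.length := fun q => by omega
  simp only [Occ, at_append_left hp, at_append_left (this _)]

theorem occCount_append {z w : List (Bool ⊕ Bool)} {q : ℕ} (hq : q ≤ z.length) (i : ℕ) :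
    occCount (z ++ w) q i = occCount z q i := by
  rw [occCount, occCount]
  congr 1
  ext p
  simp only [Finset.mem_filter]
  refine and_congr_right fun hp => ?_
  exact Occ.append_iff ((Finset.mem_range.1 hp).trans_le hq)

open Classical in
theorem occCount_succ (z : List (Bool ⊕ Bool)) (q i : ℕ) :
    occCount z (q + 1) i = occCount z q i + if Occ z q i then 1 else 0 := by
  rw [occCount, occCount, Finset.range_add_one, Finset.filter_insert]
  split_ifs
  · rw [Finset.card_insert_of_notMem (by simp)]
  · rfl

/-- Appending the code of a letter to a string. -/
theorem occ_append_letter {z : List (Bool ⊕ Bool)} (hz : z ≠ [])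
    (hz' : ¬ At (isSnd true) z (z.length - 1)) (v i : ℕ) :
    Occ (z ++ (List.replicate v (Sum.inr true) ++ [Sum.inr false])) (z.length + v) i ↔ i = v := by
  have hpos := List.length_pos_iff.2 hz
  have h₁ : ∀ q < v, At (isSnd true) (z ++ (List.replicate v (Sum.inr true) ++ [Sum.inr false]))
      (z.length + v - 1 - q) := fun q hq => by
    rw [show z.length + v - 1 - q = z.length + (v - 1 - q) by omega, at_append_right,
      at_append_left (by simp; omega)]
    simp [At, isSnd, show v - 1 - q < v by omega]
  have h₂ : ¬ At (isSnd true) (z ++ (List.replicate v (Sum.inr true) ++ [Sum.inr false]))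
      (z.length + v - 1 - v) := by
    rwa [show z.length + v - 1 - v = z.length - 1 by omega, at_append_left (by omega)]
  constructor
  · rintro ⟨-, h₃, h₄⟩
    rcases lt_trichotomy i v with h | h | h
    · exact absurd (h₁ i h) h₄
    · exact h
    · exact absurd (h₃ v h) h₂
  · rintro rfl
    refine ⟨?_, h₁, h₂⟩
    rw [at_append_right]
    simp [At, isSnd]

theorem occCount_append_letter {z : List (Bool ⊕ Bool)} (v i t : ℕ) (ht : t ≤ v) :
    occCount (z ++ (List.replicate v (Sum.inr true) ++ [Sum.inr false])) (z.length + t) i =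
      occCount z z.length i := by
  induction t with
  | zero => exact occCount_append le_rfl i
  | succ t ih =>
    have hocc : ¬ Occ (z ++ (List.replicate v (Sum.inr true) ++ [Sum.inr false]))
        (z.length + t) i := by
      rintro ⟨h, -⟩
      rw [at_append_right, at_append_left (by simp; omega)] at h
      simp [At, isSnd, show t < v by omega] at h
    rw [← Nat.add_assoc, occCount_succ, ih (by omega), if_neg hocc, Nat.add_zero]

/-- The numbers of occurrences at the positions of a string with a word are those in the prefixes
of the word. -/
theorem occCount_encodeNatWord {x : List Bool} (hx : x ≠ []) (W : List ℕ) :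
    let z := x.map Sum.inl ++ (encodeNatWord W).map Sum.inr
    ¬ At (isSnd true) z (z.length - 1) ∧
    (∀ q ≤ z.length, ∃ P, P <+: W ∧ ∀ i, occCount z q i = P.count i) ∧
    (∀ P, P <+: W → ∃ q ≤ z.length, ∀ i, occCount z q i = P.count i) ∧
    ∀ i, occCount z z.length i = W.count i := by
  induction W using List.reverseRecOn with
  | nil =>
    have hAt : ∀ b p, ¬ At (isSnd b) (x.map Sum.inl) p := fun b p => by
      simp [At, isSnd, Option.any_map]
    have h : ∀ q i, occCount (x.map Sum.inl) q i = 0 := fun q i => by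
      simp only [occCount, Finset.card_eq_zero, Finset.filter_eq_empty_iff]
      rintro p - ⟨h, -⟩
      exact hAt _ _ h
    simp only [encodeNatWord, List.flatMap_nil, List.map_nil, List.append_nil]
    refine ⟨hAt _ _, fun q _ => ⟨[], List.nil_prefix, fun i => by simp [h]⟩, fun P hP => ?_,
      fun i => by simp [h]⟩
    rw [List.prefix_nil.1 hP]
    exact ⟨0, Nat.zero_le _, fun i => by simp [h]⟩
  | append_singleton W v ih =>
    obtain ⟨h₁, h₂, h₃, h₄⟩ := ih
    have hz : x.map Sum.inl ++ (encodeNatWord (W ++ [v])).map Sum.inr =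
        (x.map Sum.inl ++ (encodeNatWord W).map Sum.inr) ++
          (List.replicate v (Sum.inr true) ++ [Sum.inr false]) := by
      simp [encodeNatWord]
    simp only [hz]
    set z := x.map Sum.inl ++ (encodeNatWord W).map Sum.inr with hzdef
    have hz₀ : z ≠ [] := by simp [hzdef, hx]
    set z' := z ++ (List.replicate v (Sum.inr true) ++ [Sum.inr false]) with hz'
    have hlen : z'.length = z.length + v + 1 := by simp [hz']; omega
    have hfull : ∀ i, occCount z' z'.length i = (W ++ [v]).count i := fun i => by
      rw [hlen, occCount_succ, hz', occCount_append_letter v i v le_rfl, h₄, List.count_append]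
      congr 1
      simp only [occ_append_letter hz₀ h₁, List.count_singleton]
      by_cases h : i = v
      · simp [h]
      · simp [h, Ne.symm h]
    refine ⟨?_, fun q hq => ?_, fun P hP => ?_, hfull⟩
    · rw [hlen, Nat.add_sub_cancel, hz', at_append_right]
      simp [At, isSnd]
    · rcases le_or_gt q z.length with hqz | hqz
      · obtain ⟨P, hP, hP'⟩ := h₂ q hqz
        exact ⟨P, hP.trans (List.prefix_append _ _), fun i => by rw [hz', occCount_append hqz, hP']⟩
      · rcases hq.eq_or_lt with rfl | hq
        · exact ⟨_, List.prefix_rfl, hfull⟩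
        -- A cut inside the last code precedes its final zero, so the last letter is not counted
        -- yet.
        · obtain ⟨t, rfl⟩ := Nat.exists_eq_add_of_le hqz.le
          exact ⟨W, List.prefix_append _ _, fun i => by
            rw [hz', occCount_append_letter v i t (by omega), h₄]⟩
    · rcases List.prefix_concat_iff.1 hP with rfl | hP
      · exact ⟨_, le_rfl, hfull⟩
      · obtain ⟨q, hq, hq'⟩ := h₃ P hP
        exact ⟨q, by omega, fun i => by rw [hz', occCount_append hq, hq']⟩

/-- Cuts of the string and prefixes of the word produce the same count profiles. -/
theorem leadsAt_iff {n : ℕ} {x : List Bool} (hx : x ≠ []) (W : List (Fin n)) (i j : Fin n) :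
    LeadsAt (x.map Sum.inl ++ (encodeWord W).map Sum.inr) i j ↔ Leads W i j := by
  have hcount : ∀ (P : List (Fin n)) (k : Fin n), (P.map Fin.val).count (k : ℕ) = P.count k :=
    fun P k => List.count_map_of_injective P Fin.val Fin.val_injective k
  obtain ⟨-, h₂, h₃, -⟩ := occCount_encodeNatWord hx (W.map Fin.val)
  rw [encodeWord_eq]
  constructor
  · intro h P hP
    obtain ⟨q, hq, hq'⟩ := h₃ (P.map Fin.val) (hP.map Fin.val)
    have := h q (Nat.lt_succ_of_le hq)
    rwa [hq', hq', hcount, hcount] at this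
  · intro h q hq
    obtain ⟨P, hP, hP'⟩ := h₂ q (Nat.le_of_lt_succ hq)
    have hP₁ : P = (W.take P.length).map Fin.val := by
      rw [List.map_take]
      exact List.prefix_iff_eq_take.1 hP
    have := h _ (List.take_prefix P.length W)
    rw [hP', hP', hP₁, hcount, hcount]
    exact this

theorem uniformWordCertificate_iff (x y : List Bool) : UniformWordCertificate x y ↔
    ∃ n < (x.map Sum.inl ++ y.map Sum.inr).length,
      IsCertified (x.map Sum.inl ++ y.map Sum.inr) n := by
  classical
  constructor
  · rintro ⟨n, G, k, W, rfl, rfl, hk, hW, hr⟩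
    have hlen := length_encodeGraph G
    have hx : encodeGraph G ≠ [] := List.ne_nil_of_length_pos (by omega)
    have hleads := leadsAt_iff hx W
    obtain ⟨h₁, -, -, h₄⟩ := occCount_encodeNatWord hx (W.map Fin.val)
    rw [← encodeWord_eq] at h₁ h₄
    have hcount : ∀ (k : Fin n), (W.map Fin.val).count (k : ℕ) = W.count k :=
      fun k => List.count_map_of_injective W Fin.val Fin.val_injective k
    have hadj : ∀ i j (hi : i < n) (hj : j < n), At (isFst true)
        ((encodeGraph G).map Sum.inl ++ (encodeWord W).map Sum.inr) (n + 1 + i * n + j) ↔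
        G.Adj ⟨i, hi⟩ ⟨j, hj⟩ := fun i j hi hj => by
      rw [at_isFst_iff]
      have := getElem?_encodeGraph G ⟨i, hi⟩ ⟨j, hj⟩
      simp only at this
      simp [this]
    refine ⟨n, ?_, ⟨fun q hq => ?_, ?_, ?_⟩, fun i hi => ?_, fun i hi j hj h => ?_, h₁,
      fun i _ hi => ?_, ⟨k, by omega, fun i hi => ?_⟩, fun i hi j hj hij => ?_⟩
    · simp only [List.length_append, List.length_map]
      omega
    · rw [at_isFst_iff, getElem?_encodeGraph_of_lt G hq]
    · rw [at_isFst_iff, getElem?_encodeGraph_self]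
    · rw [fstLength_eq, hlen]
    · rw [hadj i i hi hi]
      exact G.loopless.irrefl _
    · rw [hadj i j hi hj] at h
      rw [hadj j i hj hi]
      exact h.symm
    · rw [h₄, List.count_eq_zero]
      intro h
      obtain ⟨v, -, rfl⟩ := List.mem_map.1 h
      omega
    · have hk' : W.count ⟨i, hi⟩ = k := hW _
      have := hcount ⟨i, hi⟩
      simp only at this
      rw [h₄, this, hk']
      exact ⟨rfl, hk' ▸ List.count_pos_iff.2 (hr.1 _)⟩
    · have hne : (⟨i, hi⟩ : Fin n) ≠ ⟨j, hj⟩ := fun h => hij (Fin.mk.inj h)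
      rw [hadj i j hi hj, hr.2 _ _ hne, alternate_iff hne]
      exact or_congr (hleads ⟨i, hi⟩ ⟨j, hj⟩).symm (hleads ⟨j, hj⟩ ⟨i, hi⟩).symm
  · rintro ⟨n, -, ⟨htrue, hfalse, hlen⟩, hirr, hsymm, hlast, hle, ⟨k, hk, hunif⟩, hrep⟩
    rw [fstLength_eq] at hlen
    rw [at_isFst_iff] at hfalse
    have hx : x ≠ [] := List.ne_nil_of_length_pos (by omega)
    obtain ⟨W, rfl⟩ := exists_encodeNatWord y (by
      rintro y' rfl
      apply hlast
      have h : (x.map Sum.inl ++ (y' ++ [true]).map Sum.inr : List (Bool ⊕ Bool)).length - 1 =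
          (x.map Sum.inl ++ y'.map Sum.inr : List (Bool ⊕ Bool)).length + 0 := by
        simp
      rw [h, List.map_append, ← List.append_assoc, at_append_right]
      simp [At, isSnd])
    have h₄ := (occCount_encodeNatWord hx W).2.2.2
    have hlt : ∀ v ∈ W, v < n := by
      intro v hv
      by_contra hnv
      have h₅ := hle v (by
        have := lt_length_encodeNatWord hv
        simp only [List.length_append, List.length_map]
        omega) (by omega)
      rw [h₄, List.count_eq_zero] at h₅
      exact h₅ hv
    lift W to List (Fin n) using hlt
    have hcount : ∀ (k : Fin n), (W.map Fin.val).count (k : ℕ) = W.count k :=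
      fun k => List.count_map_of_injective W Fin.val Fin.val_injective k
    have hW : ∀ v, W.count v = k ∧ 1 ≤ k := fun v => by
      have := hunif v v.2
      rwa [h₄, hcount] at this
    rw [← encodeWord_eq] at hrep
    obtain ⟨G, hG⟩ : ∃ G : SimpleGraph (Fin n),
        ∀ i j : Fin n, G.Adj i j ↔ x[n + 1 + (i : ℕ) * n + j]? = some true :=
      ⟨{ Adj := fun i j => x[n + 1 + (i : ℕ) * n + j]? = some true
         symm := ⟨fun i j h => at_isFst_iff.1 (hsymm i i.2 j j.2 (at_isFst_iff.2 h))⟩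
         loopless := ⟨fun i h => hirr i i.2 (at_isFst_iff.2 h)⟩ }, fun _ _ => Iff.rfl⟩
    refine ⟨n, G, k, W, ?_, encodeWord_eq W, by omega, fun v => (hW v).1, fun v => ?_,
      fun i j hij => ?_⟩
    · have hlen' := length_encodeGraph G
      refine List.ext_getElem? fun p => ?_
      rcases lt_trichotomy p n with hp | rfl | hp
      · rw [getElem?_encodeGraph_of_lt G hp, at_isFst_iff.1 (htrue p hp)]
      · rw [getElem?_encodeGraph_self, hfalse]
      · obtain ⟨q, rfl⟩ : ∃ q, p = n + 1 + q := Nat.exists_eq_add_of_le hp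
        rcases lt_or_ge q (n * n) with hq | hq
        · have hn : 0 < n := Nat.pos_of_ne_zero fun h => by simp [h] at hq
          obtain ⟨i, j, rfl⟩ : ∃ i j : Fin n, q = i * n + j :=
            ⟨⟨q / n, Nat.div_lt_of_lt_mul hq⟩, ⟨q % n, Nat.mod_lt _ hn⟩, (Nat.div_add_mod' q n).symm⟩
          have hp' : n + 1 + (i * n + j) < x.length := by omega
          rw [← Nat.add_assoc, getElem?_encodeGraph]
          rw [← Nat.add_assoc] at hp'
          have hA := hG i j
          rw [List.getElem?_eq_getElem hp', Option.some.injEq] at hA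
          rw [List.getElem?_eq_getElem hp', Option.some.injEq]
          exact Bool.eq_iff_iff.2 (decide_eq_true_iff.trans hA)
        · rw [List.getElem?_eq_none (by omega), List.getElem?_eq_none (by omega)]
    · exact List.count_pos_iff.1 ((hW v).1 ▸ (hW v).2)
    · rw [hG, alternate_iff hij, ← leadsAt_iff hx, ← leadsAt_iff hx,
        ← hrep i i.2 j j.2 (fun h => hij (Fin.ext h)), at_isFst_iff]

/-- There are `n * k` letters, each with a code of at most `n` bits. -/
theorem length_encodeWord_le {n k : ℕ} {W : List (Fin n)} (hW : IsUniform k W) :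
    (encodeWord W).length ≤ n * k * n := by
  have h₁ : W.length = n * k := by
    have := Multiset.sum_count_eq_card (s := Finset.univ) (m := (W : Multiset (Fin n)))
      (fun a _ => Finset.mem_univ a)
    simp only [Multiset.coe_count, Multiset.coe_card] at this
    rw [← this, Finset.sum_congr rfl fun v _ => hW v]
    simp
  rw [← h₁]
  clear h₁ hW
  induction W with
  | nil => simp [encodeWord]
  | cons a W ih =>
    have : (encodeWord (a :: W)).length = a + 1 + (encodeWord W).length := by
      rw [encodeWord_eq, encodeWord_eq, encodeNatWord, List.map_cons, List.flatMap_cons,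
        List.length_append, ← encodeNatWord]
      simp
    rw [this, List.length_cons, Nat.succ_mul]
    have := a.2
    omega

end Encodings

/-! ### The polynomial-time verifier -/

section Main

open Computability Turing

theorem polyTimeDecidable_uniformWordCertificate : PolyTimeDecidable UniformWordCertificate := by
  classical
  refine ⟨fun p => decide (UniformWordCertificate p.1 p.2), fun x y => by simp, ?_⟩
  refine Term.nonempty_computable _ _ (.ex .len certifiedTerm) fun p => ?_
  rw [decide_eq_true_iff, uniformWordCertificate_iff]
  change _ ↔ Term.Holds _ _ _
  rw [Term.holds_ex]
  simp only [holds_certifiedTerm]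
  rfl

theorem isPolyTimeVerifier_uniformWordCertificate :
    IsPolyTimeVerifier UniformWordCertificate representableGraphs := by
  -- An n-uniform word has a code of length at most n³, and n is at most the length of the encoded
  -- graph.
  refine ⟨polyTimeDecidable_uniformWordCertificate, .X ^ 3, fun x => ⟨?_, ?_⟩⟩
  · rintro ⟨n, G, hG, rfl⟩
    obtain ⟨W, hW, hr⟩ := hG.exists_uniform
    rw [Fintype.card_fin] at hW
    refine ⟨encodeWord W, ?_, n, G, n, W, rfl, rfl, le_rfl, hW, hr⟩
    refine (length_encodeWord_le hW).trans ?_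
    rw [Polynomial.eval_pow, Polynomial.eval_X, ← pow_two, ← pow_succ]
    exact Nat.pow_le_pow_left (by rw [length_encodeGraph]; omega) 3
  · rintro ⟨y, -, n, G, k, W, rfl, -, -, -, hr⟩
    exact ⟨n, G, ⟨W, hr⟩, rfl⟩

end Main

end WordRep

theorem corollary14 :
    WordRep.representableGraphs ∈ WordRep.NP ∧
      WordRep.IsPolyTimeVerifier WordRep.UniformWordCertificate WordRep.representableGraphs :=
  ⟨⟨_, WordRep.isPolyTimeVerifier_uniformWordCertificate⟩,
    WordRep.isPolyTimeVerifier_uniformWordCertificate⟩
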